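/- Let $(X_n)_{n\ge 1}$ be a strictly stationary, 1-dependent sequence of real random variables on a probability space, i.e. for every $t\ge 1$ the $\sigma$-algebras $\sigma(X_1,\dots,X_t)$ and $\sigma(X_{t+2},X_{t+3},\dots)$ are independent. For $x\in\mathbb R$ and $n\ge1$ put $$p_n=p_n(x)=\mathbb P(\min\{X_1,\dots,X_n\}>x),\quad p_0=1,\qquad q_n=q_n(x)=\mathbb P(\max\{X_1,\dots,X_n\}\le x),$$ $$C(z)=C_x(z)=1+\sum_{k=1}^{\infty}(-1)^kp_{k-1}z^k .$$ Let $x$ and $\alpha$ be such that $0<p_1(x)\le\alpha\le 0.1$. Let $t_2=t_2(\alpha)$ be the second, in increasing order, of the three real roots of $\alpha t^3-t+1=0$ (equivalently, its smallest positive root). Let $l>t_2^3$, put $\eta=1+l\alpha$, and assume $$\left(1-\alpha\eta^2\right)^2-\alpha\eta^2\left(1+\eta-2\alpha\eta\right)^2>0$$ (this holds whenever $t_2+(l-t_2^3)<1/\sqrt{3\alpha}$, in particular for every $l$ close enough to $t_2^3$). Define $$K(\alpha)=\frac{\frac{11-3\alpha}{(1-\alpha)^2}+2l(1+3\alpha)\frac{2+3l\alpha-\alpha(2-l\alpha)(1+l\alpha)^2}{\left[1-\alpha(1+l\alpha)^2\right]^3}}{1-\frac{2\alpha(1+l\alpha)}{\left[1-\alpha(1+l\alpha)^2\right]^2}},$$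 $$L(\alpha)=3K(\alpha)(1+\alpha+3\alpha^2)\left[1+\alpha+3\alpha^2+K(\alpha)\alpha^3\right]+\alpha^6K(\alpha)^3+9\alpha(4+3\alpha+3\alpha^2)+55,$$ $$E(\alpha)=0.1+\frac{\eta^5\left[1+(1-2\alpha)\eta\right]^4\left[1+\alpha(\eta-2)\right]\left[1+\eta+(1-3\alpha)\eta^2\right]}{2(1-\alpha\eta^2)^4\left[(1-\alpha\eta^2)^2-\alpha\eta^2(1+\eta-2\alpha\eta)^2\right]},$$ $$\Gamma(\alpha)=L(\alpha)+E(\alpha).$$ Then the series $C(z)$ converges for every real $z\in(1,1+lp_1)$, the function $C$ has exactly one zero $\lambda=\lambda(x)$ in $(1,1+lp_1)$, this zero is simple, and for every $n\ge 1$ $$\left|q_n\lambda^n-(1-p_2)\right|\le\left(3+\alpha\,\Gamma(\alpha)\right)p_1^2 .$$ -/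

import Mathlib

open MeasureTheory ProbabilityTheory

noncomputable section

namespace OneDependent

section Sequence

variable {Ω : Type*} [MeasurableSpace Ω]

/-- Strict stationarity of a sequence: every time shift of the process has the same law
(on the sequence space) as the process itself.  The sequence is indexed from `0`, so that
`X i` is the variable usually written `X_{i+1}`. -/
def StrictlyStationary (μ : Measure Ω) (X : ℕ → Ω → ℝ) : Prop :=
  ∀ k : ℕ, μ.map (fun ω (i : ℕ) => X (i + k) ω) = μ.map (fun ω (i : ℕ) => X i ω)

/-- 1-dependence: for every `t`, the σ-algebra generated by the first `t` variables
`X 0, …, X (t - 1)` is independent of the one generated by `X (t + 1), X (t + 2), …`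
(only the variable `X t` is skipped). -/
def OneDep (μ : Measure Ω) (X : ℕ → Ω → ℝ) : Prop :=
  ∀ t : ℕ, 1 ≤ t →
    Indep (⨆ i ∈ Set.Iio t, MeasurableSpace.comap (X i) inferInstance)
      (⨆ i ∈ Set.Ici (t + 1), MeasurableSpace.comap (X i) inferInstance) μ

/-- `p_n(x)`: the probability that the minimum of the first `n` variables exceeds `x`.
For a probability measure `p_0 = 1`. -/
def p (μ : Measure Ω) (X : ℕ → Ω → ℝ) (x : ℝ) (n : ℕ) : ℝ :=
  μ.real {ω | ∀ i < n, x < X i ω}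

/-- `q_n(x)`: the probability that the maximum of the first `n` variables is at most `x`. -/
def q (μ : Measure Ω) (X : ℕ → Ω → ℝ) (x : ℝ) (n : ℕ) : ℝ :=
  μ.real {ω | ∀ i < n, X i ω ≤ x}

/-- The `k`-th term, `k ≥ 0`, of the series below: `(-1)^{k+1} p_k z^{k+1}`. -/
def seriesTerm (μ : Measure Ω) (X : ℕ → Ω → ℝ) (x z : ℝ) (k : ℕ) : ℝ :=
  (-1) ^ (k + 1) * p μ X x k * z ^ (k + 1)

/-- `C_x(z) = 1 + ∑_{k ≥ 1} (-1)^k p_{k-1} z^k`, with the summation index shifted by one. -/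
def C (μ : Measure Ω) (X : ℕ → Ω → ℝ) (x z : ℝ) : ℝ :=
  1 + ∑' k : ℕ, seriesTerm μ X x z k

end Sequence

/-- `t` is a real root of `α t³ - t + 1 = 0`. -/
def IsRootCubic (α t : ℝ) : Prop := α * t ^ 3 - t + 1 = 0

/-- `t` is the second, in increasing order, of the three real roots of `α t³ - t + 1 = 0`. -/
def IsSecondRoot (α t : ℝ) : Prop :=
  IsRootCubic α t ∧ (∃ s, s < t ∧ IsRootCubic α s) ∧ (∃ r, t < r ∧ IsRootCubic α r)

/-- `η = 1 + l α`. -/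
def eta (α l : ℝ) : ℝ := 1 + l * α

/-- The coefficient `K(α)`, for a given choice of `l = l(α)`. -/
def coeffK (α l : ℝ) : ℝ :=
  ((11 - 3 * α) / (1 - α) ^ 2
      + 2 * l * (1 + 3 * α)
        * ((2 + 3 * l * α - α * (2 - l * α) * (1 + l * α) ^ 2)
            / (1 - α * (1 + l * α) ^ 2) ^ 3))
    / (1 - 2 * α * (1 + l * α) / (1 - α * (1 + l * α) ^ 2) ^ 2)

/-- The coefficient `L(α)`. -/
def coeffL (α l : ℝ) : ℝ :=
  3 * coeffK α l * (1 + α + 3 * α ^ 2) * (1 + α + 3 * α ^ 2 + coeffK α l * α ^ 3)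
    + α ^ 6 * coeffK α l ^ 3
    + 9 * α * (4 + 3 * α + 3 * α ^ 2) + 55

/-- The square bracket `(1 - α η²)² - α η² (1 + η - 2 α η)²` in the denominator of `E(α)`. -/
def bracketE (α l : ℝ) : ℝ :=
  (1 - α * eta α l ^ 2) ^ 2
    - α * eta α l ^ 2 * (1 + eta α l - 2 * α * eta α l) ^ 2

/-- The coefficient `E(α)`. -/
def coeffE (α l : ℝ) : ℝ :=
  0.1 + (eta α l ^ 5 * (1 + (1 - 2 * α) * eta α l) ^ 4 * (1 + α * (eta α l - 2))
        * (1 + eta α l + (1 - 3 * α) * eta α l ^ 2))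
      / (2 * (1 - α * eta α l ^ 2) ^ 4 * bracketE α l)

/-- `Γ(α) = L(α) + E(α)`. -/
def coeffGamma (α l : ℝ) : ℝ := coeffL α l + coeffE α l

end OneDependent

end

noncomputable section

namespace OneDependent

/-! ### Joint probabilities of low and high blocks in a 1-dependent sequence -/

section Probability

variable {Ω : Type*} [MeasurableSpace Ω]

/-! Splitting on the value at one position and using 1-dependence gives the renewal recursion
`q_eq_sum`. In terms of power series, if `c` has the terms of `C(z)` as coefficients and `r` is the
sequence `1, q 0 z, q 1 z², …`, then `c` and `r` are inverse to each other under convolution.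

The zero is found by monotonicity. Domination by a geometric series of ratio `p 1 z²` makes `1 - C`
differentiable with positive derivative, and its values at the two ends of the interval lie on
either side of `1` (`exists_unique_zero`).

At the zero `z = λ`, summation by parts moves the factor vanishing at the zero from `C` to `r`: the
partial sums `β` of `c` are, up to sign, tails of a convergent alternating series, and they are the
convolution inverse of the increments `y` of `r` (`sum_antidiagonal_partialSum_mul_diff`). The
coefficients `β` decay geometrically and have total mass below 1 apart from `β 0`, so `y` is
summable with explicit bounds. Hence `q n λ^(n+1)` is a partial sum of `y`. The terms `y 0, …, y 4`
are polynomials in `λ - 1` and the tails, and give `3 p₁²` up to `60 p₁³` (`main_one`, `main_two`,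
`main_three`); the later terms add at most `48 p₁³` (`tail_le`).

The result is an error `3 p₁² + 112 p₁³` with an absolute constant (`abs_sub_le`). The coefficient
`Γ(α)` enters only through the crude bound `Γ(α) ≥ 112` (`coeffGamma_lower`). -/

lemma measurableSet_forall_lt {X : ℕ → Ω → ℝ} (hX : ∀ i, Measurable (X i)) {P : Set ℝ}
    (hP : MeasurableSet P) (m j : ℕ) : MeasurableSet {ω | ∀ i < m, X (i + j) ω ∈ P} := by
  simp only [Set.ofPred_forall]
  exact MeasurableSet.iInter fun i => MeasurableSet.iInter fun _ => hX _ hP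

lemma StrictlyStationary.measureReal_shift {μ : Measure Ω} {X : ℕ → Ω → ℝ}
    (hX : ∀ i, Measurable (X i)) (h : StrictlyStationary μ X) {P : Set ℝ}
    (hP : MeasurableSet P) (m j : ℕ) :
    μ.real {ω | ∀ i < m, X (i + j) ω ∈ P} = μ.real {ω | ∀ i < m, X i ω ∈ P} := by
  have hS : MeasurableSet {f : ℕ → ℝ | ∀ i < m, f i ∈ P} := by
    simp only [Set.ofPred_forall]
    exact MeasurableSet.iInter fun i => MeasurableSet.iInter fun _ => measurable_pi_apply i hP
  have h1 := congrArg (fun ν : Measure (ℕ → ℝ) => ν.real {f : ℕ → ℝ | ∀ i < m, f i ∈ P}) (h j)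
  beta_reduce at h1
  rw [map_measureReal_apply (measurable_pi_lambda _ fun i => hX _) hS,
    map_measureReal_apply (measurable_pi_lambda _ fun i => hX _) hS] at h1
  exact h1

/-- Independence of two blocks separated by one index, with the second one moved to the origin. -/
lemma OneDep.measureReal_blocks {μ : Measure Ω} [IsProbabilityMeasure μ] {X : ℕ → Ω → ℝ}
    (hX : ∀ i, Measurable (X i)) (hstat : StrictlyStationary μ X) (hdep : OneDep μ X)
    {P Q : Set ℝ} (hP : MeasurableSet P) (hQ : MeasurableSet Q) (m k : ℕ) :
    μ.real ({ω | ∀ i < m, X i ω ∈ P} ∩ {ω | ∀ i < k, X (i + (m + 1)) ω ∈ Q}) =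
      μ.real {ω | ∀ i < m, X i ω ∈ P} * μ.real {ω | ∀ i < k, X i ω ∈ Q} := by
  rw [← hstat.measureReal_shift hX hQ k (m + 1)]
  -- `OneDep` says nothing for `t = 0`; there the first block is empty and its event is the whole
  -- space.
  rcases Nat.eq_zero_or_pos m with rfl | hm
  · simp
  · have hind := (Indep_iff _ _ _).1 (hdep m hm)
    simp only [Measure.real]
    rw [← ENNReal.toReal_mul]
    congr 1
    apply hind
    · have : {ω | ∀ i < m, X i ω ∈ P} = ⋂ i ∈ Set.Iio m, X i ⁻¹' P := by
        ext; simp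
      rw [this]
      refine MeasurableSet.biInter (Set.to_countable _) fun i hi => ?_
      exact le_iSup₂ (f := fun i (_ : i ∈ Set.Iio m) =>
        MeasurableSpace.comap (X i) inferInstance) i hi _ ⟨P, hP, rfl⟩
    · have : {ω | ∀ i < k, X (i + (m + 1)) ω ∈ Q} =
          ⋂ i ∈ Set.Iio k, X (i + (m + 1)) ⁻¹' Q := by
        ext; simp
      rw [this]
      refine MeasurableSet.biInter (Set.to_countable _) fun i _ => ?_
      exact le_iSup₂ (f := fun i (_ : i ∈ Set.Ici (m + 1)) =>
        MeasurableSpace.comap (X i) inferInstance) (i + (m + 1)) (by simp) _ ⟨Q, hQ, rfl⟩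

variable {μ : Measure Ω} {X : ℕ → Ω → ℝ} {x : ℝ}

lemma p_nonneg (n : ℕ) : 0 ≤ p μ X x n := measureReal_nonneg

/-- The probability that the first `m` variables are at most `x` and the next `k` exceed `x`. -/
def lowHigh (μ : Measure Ω) (X : ℕ → Ω → ℝ) (x : ℝ) (m k : ℕ) : ℝ :=
  μ.real ({ω | ∀ i < m, X i ω ∈ Set.Iic x} ∩ {ω | ∀ i < k, X (i + m) ω ∈ Set.Ioi x})

lemma lowHigh_zero_left (k : ℕ) : lowHigh μ X x 0 k = p μ X x k := by
  simp [lowHigh, p]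

lemma lowHigh_zero_right (m : ℕ) : lowHigh μ X x m 0 = q μ X x m := by
  simp [lowHigh, q]

variable [IsProbabilityMeasure μ]

lemma p_zero : p μ X x 0 = 1 := by simp [p]

lemma p_anti : Antitone (p μ X x) := fun _ _ h =>
  measureReal_mono fun _ hω i hi => hω i (hi.trans_le h)

/-- Forgetting the variable at position `m` leaves two blocks that 1-dependence makes independent.
-/
lemma p_add_add_one_le (hX : ∀ i, Measurable (X i)) (hstat : StrictlyStationary μ X)
    (hdep : OneDep μ X) (m k : ℕ) : p μ X x (m + k + 1) ≤ p μ X x m * p μ X x k := by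
  refine le_trans ?_ (hdep.measureReal_blocks hX hstat measurableSet_Ioi measurableSet_Ioi
    (P := Set.Ioi x) (Q := Set.Ioi x) m k).le
  refine measureReal_mono fun ω hω => ⟨fun i hi => hω i (by omega), fun i hi => hω _ (by omega)⟩

/-- Inclusion–exclusion for two overlapping pairs: both events lie in the one for the shared middle
variable. This brings `p 2` down to about half of `p 1`; monotonicity alone would not suffice at `z
= 1`. -/
lemma two_mul_p_two_le (hX : ∀ i, Measurable (X i)) (hstat : StrictlyStationary μ X) :
    2 * p μ X x 2 ≤ p μ X x 1 + p μ X x 3 := by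
  have hA : ∀ m j, MeasurableSet {ω | ∀ i < m, X (i + j) ω ∈ Set.Ioi x} := fun m j =>
    measurableSet_forall_lt hX measurableSet_Ioi m j
  have h2 := hstat.measureReal_shift hX (P := Set.Ioi x) measurableSet_Ioi 2 1
  have h1 := hstat.measureReal_shift hX (P := Set.Ioi x) measurableSet_Ioi 1 1
  have hu := measureReal_union_add_inter (μ := μ)
    (s := {ω | ∀ i < 2, X (i + 0) ω ∈ Set.Ioi x}) (hA 2 1)
  have e1 : ({ω | ∀ i < 2, X (i + 0) ω ∈ Set.Ioi x} ∩ {ω | ∀ i < 2, X (i + 1) ω ∈ Set.Ioi x}) =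
      {ω | ∀ i < 3, x < X i ω} := by
    ext ω
    simp only [Set.mem_inter_iff, Set.mem_ofPred_eq, Set.mem_Ioi, add_zero]
    constructor
    · rintro ⟨ha, hb⟩ i hi
      interval_cases i
      · exact ha 0 (by omega)
      · exact ha 1 (by omega)
      · exact hb 1 (by omega)
    · intro h
      exact ⟨fun i hi => h i (by omega), fun i hi => h _ (by omega)⟩
  have e2 : μ.real ({ω | ∀ i < 2, X (i + 0) ω ∈ Set.Ioi x} ∪
      {ω | ∀ i < 2, X (i + 1) ω ∈ Set.Ioi x}) ≤ μ.real {ω | ∀ i < 1, X (i + 1) ω ∈ Set.Ioi x} := by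
    refine measureReal_mono ?_
    rintro ω (h | h) i hi
    · obtain rfl : i = 0 := by omega
      exact h 1 (by omega)
    · exact h i (by omega)
  rw [e1] at hu
  rw [h1] at e2
  rw [h2] at hu
  simp only [Set.mem_Ioi, add_zero] at hu e2
  simp only [p]
  linarith

/-- With `X m` left free, the `m` low and the `k` high variables are independent; `X m` then either
prolongs the low block or joins the high one. -/
lemma lowHigh_succ_left (hX : ∀ i, Measurable (X i)) (hstat : StrictlyStationary μ X)
    (hdep : OneDep μ X) (m k : ℕ) :
    lowHigh μ X x (m + 1) k = q μ X x m * p μ X x k - lowHigh μ X x m (k + 1) := by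
  have h := hdep.measureReal_blocks hX hstat measurableSet_Iic measurableSet_Ioi
    (P := Set.Iic x) (Q := Set.Ioi x) m k
  have hs := measureReal_inter_add_sdiff (μ := μ) (s :=
    {ω | ∀ i < m, X i ω ∈ Set.Iic x} ∩ {ω | ∀ i < k, X (i + (m + 1)) ω ∈ Set.Ioi x})
    (hX m measurableSet_Iic (t := Set.Iic x))
  have e1 : ({ω | ∀ i < m, X i ω ∈ Set.Iic x} ∩ {ω | ∀ i < k, X (i + (m + 1)) ω ∈ Set.Ioi x}) ∩
      X m ⁻¹' Set.Iic x =
      {ω | ∀ i < m + 1, X i ω ∈ Set.Iic x} ∩ {ω | ∀ i < k, X (i + (m + 1)) ω ∈ Set.Ioi x} := by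
    ext ω
    simp only [Set.mem_inter_iff, Set.mem_ofPred_eq, Set.mem_preimage]
    constructor
    · rintro ⟨⟨ha, hb⟩, hc⟩
      refine ⟨fun i hi => ?_, hb⟩
      rcases Nat.lt_succ_iff_lt_or_eq.1 hi with h | rfl
      · exact ha i h
      · exact hc
    · rintro ⟨ha, hb⟩
      exact ⟨⟨fun i hi => ha i (by omega), hb⟩, ha m (by omega)⟩
  have e2 : ({ω | ∀ i < m, X i ω ∈ Set.Iic x} ∩ {ω | ∀ i < k, X (i + (m + 1)) ω ∈ Set.Ioi x}) \
      X m ⁻¹' Set.Iic x =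
      {ω | ∀ i < m, X i ω ∈ Set.Iic x} ∩ {ω | ∀ i < k + 1, X (i + m) ω ∈ Set.Ioi x} := by
    ext ω
    simp only [Set.mem_inter_iff, Set.mem_ofPred_eq, Set.mem_preimage, Set.mem_sdiff, Set.mem_Iic,
      Set.mem_Ioi, not_le]
    constructor
    · rintro ⟨⟨ha, hb⟩, hc⟩
      refine ⟨ha, fun i hi => ?_⟩
      rcases i with _ | i
      · simpa using hc
      · have := hb i (by omega)
        rwa [show i + 1 + m = i + (m + 1) by ring]
    · rintro ⟨ha, hb⟩
      refine ⟨⟨ha, fun i hi => ?_⟩, by simpa using hb 0 (by omega)⟩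
      have := hb (i + 1) (by omega)
      rwa [show i + 1 + m = i + (m + 1) by ring] at this
  rw [e1, e2, h] at hs
  simp only [lowHigh]
  simp only [p, q]
  simp only [Set.mem_Iic, Set.mem_Ioi] at hs ⊢
  linarith

lemma lowHigh_eq_sum (hX : ∀ i, Measurable (X i)) (hstat : StrictlyStationary μ X)
    (hdep : OneDep μ X) (m k : ℕ) :
    lowHigh μ X x m k = ∑ i ∈ Finset.range m, (-1) ^ i * p μ X x (k + i) * q μ X x (m - 1 - i) +
      (-1) ^ m * p μ X x (k + m) := by
  induction m generalizing k with
  | zero => simp [lowHigh_zero_left]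
  | succ m ih =>
    rw [lowHigh_succ_left hX hstat hdep, ih, Finset.sum_range_succ']
    have : ∑ i ∈ Finset.range m, (-1 : ℝ) ^ (i + 1) * p μ X x (k + (i + 1)) *
        q μ X x (m + 1 - 1 - (i + 1)) = - ∑ i ∈ Finset.range m, (-1) ^ i * p μ X x (k + 1 + i) *
        q μ X x (m - 1 - i) := by
      rw [← Finset.sum_neg_distrib]
      refine Finset.sum_congr rfl fun i _ => ?_
      rw [show k + (i + 1) = k + 1 + i by ring, show m + 1 - 1 - (i + 1) = m - 1 - i by omega]
      ring
    rw [this, show k + (m + 1) = k + 1 + m by ring]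
    simp
    ring

lemma q_eq_sum (hX : ∀ i, Measurable (X i)) (hstat : StrictlyStationary μ X)
    (hdep : OneDep μ X) (n : ℕ) :
    q μ X x n = ∑ i ∈ Finset.range n, (-1) ^ i * p μ X x i * q μ X x (n - 1 - i) +
      (-1) ^ n * p μ X x n := by
  rw [← lowHigh_zero_right, lowHigh_eq_sum hX hstat hdep]
  simp

end Probability

/-! ### Tails of the alternating series and its derivative -/

section Tails

/-- The properties of the sequence `p_n` of exceedance probabilities on which the analysis of the
generating function rests. -/
structure IsExceedance (p : ℕ → ℝ) : Prop where
  zero : p 0 = 1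
  nonneg : ∀ n, 0 ≤ p n
  anti : Antitone p
  add_add_one_le : ∀ m k, p (m + k + 1) ≤ p m * p k

/-- `∑_{m ≥ 0} (-1)^m p_{j+m} z^{j+1+m}`. -/
def altTail (p : ℕ → ℝ) (z : ℝ) (j : ℕ) : ℝ :=
  ∑' m : ℕ, (-1) ^ m * p (j + m) * z ^ (j + 1 + m)

/-- Each bound discards the terms of one parity, whose sign is favourable, and compares the others
with a geometric series. -/
lemma tsum_bounds_of_even_odd {f : ℕ → ℝ} (hf : Summable f) {A B r : ℝ} (hr : 0 ≤ r)
    (hr1 : r < 1) (h0 : ∀ m, 0 ≤ f (2 * m)) (h1 : ∀ m, f (2 * m) ≤ A * r ^ m)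
    (h2 : ∀ m, f (2 * m + 1) ≤ 0) (h3 : ∀ m, -(B * r ^ m) ≤ f (2 * m + 1)) :
    -(B / (1 - r)) ≤ ∑' m, f m ∧ ∑' m, f m ≤ A / (1 - r) := by
  have he : Summable fun m => f (2 * m) :=
    hf.comp_injective (mul_right_injective₀ two_ne_zero)
  have ho : Summable fun m => f (2 * m + 1) :=
    hf.comp_injective (fun a b hab => by simpa using hab)
  have hg := summable_geometric_of_lt_one hr hr1
  have hgs := tsum_geometric_of_lt_one hr hr1
  have e1 : ∑' m, f (2 * m) ≤ A / (1 - r) := by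
    rw [div_eq_mul_inv, ← hgs, ← tsum_mul_left]
    exact he.tsum_le_tsum h1 (hg.mul_left A)
  have e2 : -(B / (1 - r)) ≤ ∑' m, f (2 * m + 1) := by
    rw [div_eq_mul_inv, ← hgs, ← tsum_mul_left, ← tsum_neg]
    exact (hg.mul_left B).neg.tsum_le_tsum h3 ho
  have e3 : 0 ≤ ∑' m, f (2 * m) := tsum_nonneg h0
  have e4 : ∑' m, f (2 * m + 1) ≤ 0 := tsum_nonpos h2
  rw [← tsum_even_add_odd he ho]
  constructor <;> linarith

namespace IsExceedance

variable {p : ℕ → ℝ} (h : IsExceedance p)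
include h

lemma one_le_one : p 1 ≤ 1 := h.zero ▸ h.anti zero_le_one

lemma odd_le (k : ℕ) : p (2 * k + 1) ≤ p 1 ^ (k + 1) := by
  induction k with
  | zero => simp
  | succ k ih =>
    calc p (2 * (k + 1) + 1) = p (1 + (2 * k + 1) + 1) := by congr 1; ring
      _ ≤ p 1 * p (2 * k + 1) := h.add_add_one_le _ _
      _ ≤ p 1 * p 1 ^ (k + 1) := by gcongr; exact h.nonneg 1
      _ = p 1 ^ (k + 1 + 1) := by ring

lemma even_le (k : ℕ) : p (2 * k + 2) ≤ p 1 ^ (k + 1) :=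
  (h.anti (by omega)).trans (h.odd_le k)

/-- One geometric majorant for both parities, giving convergence whenever `p 1 * z ^ 2 < 1`. -/
lemma le_sqrt_pow (k : ℕ) : p k ≤ √(p 1) ^ k := by
  have hs := Real.sq_sqrt (h.nonneg 1)
  rcases Nat.even_or_odd' k with ⟨m, rfl | rfl⟩
  · rw [pow_mul, hs]
    rcases m with _ | m
    · simp [h.zero]
    · exact h.even_le m
  · refine (h.odd_le m).trans ?_
    rw [pow_succ, pow_succ, pow_mul, hs]
    gcongr
    · exact pow_nonneg (h.nonneg 1) _
    · exact Real.le_sqrt_of_sq_le (by nlinarith [h.nonneg 1, h.one_le_one])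

lemma sqrt_mul_lt_one {z : ℝ} (hu : p 1 * z ^ 2 < 1) : √(p 1) * z < 1 := by
  refine lt_of_pow_lt_pow_left₀ 2 zero_le_one ?_
  rw [mul_pow, Real.sq_sqrt (h.nonneg 1)]
  simpa using hu

lemma summable_altTail {z : ℝ} (hz : 0 ≤ z) (hu : p 1 * z ^ 2 < 1) (j : ℕ) :
    Summable fun m : ℕ => (-1) ^ m * p (j + m) * z ^ (j + 1 + m) := by
  have hr := h.sqrt_mul_lt_one hu
  have hr0 : 0 ≤ √(p 1) * z := by positivity
  refine Summable.of_norm_bounded (g := fun m => (√(p 1) * z) ^ j * z * (√(p 1) * z) ^ m)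
    ((summable_geometric_of_lt_one hr0 hr).mul_left _) fun m => ?_
  rw [norm_mul, norm_mul, norm_pow, norm_neg, norm_one, one_pow, one_mul, Real.norm_eq_abs,
    Real.norm_eq_abs, abs_of_nonneg (h.nonneg _), abs_of_nonneg (pow_nonneg hz _)]
  calc p (j + m) * z ^ (j + 1 + m) ≤ √(p 1) ^ (j + m) * z ^ (j + 1 + m) := by
        gcongr; exact h.le_sqrt_pow _
    _ = _ := by ring

lemma altTail_eq {z : ℝ} (hz : 0 ≤ z) (hu : p 1 * z ^ 2 < 1) (j : ℕ) :
    altTail p z j = p j * z ^ (j + 1) - altTail p z (j + 1) := by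
  rw [altTail, (h.summable_altTail hz hu j).tsum_eq_zero_add, altTail, sub_eq_add_neg, ← tsum_neg]
  congr 1
  · simp
  · refine tsum_congr fun m => ?_
    rw [show j + (m + 1) = j + 1 + m by ring, show j + 1 + (m + 1) = j + 1 + 1 + m by ring]
    ring

/-- The available bounds on `p (2k+1)` and `p (2k+2)` coincide, so the even-indexed, negative terms
carry an extra factor `z`. -/
lemma altTail_odd_bounds {z : ℝ} (hz : 0 ≤ z) (hu : p 1 * z ^ 2 < 1) (k : ℕ) :
    -(z * (p 1 * z ^ 2) ^ (k + 1) / (1 - p 1 * z ^ 2)) ≤ altTail p z (2 * k + 1) ∧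
      altTail p z (2 * k + 1) ≤ (p 1 * z ^ 2) ^ (k + 1) / (1 - p 1 * z ^ 2) := by
  have ha := h.nonneg 1
  refine tsum_bounds_of_even_odd (h.summable_altTail hz hu _) (by positivity) hu
    (fun m => ?_) (fun m => ?_) (fun m => ?_) (fun m => ?_)
  · rw [pow_mul, neg_one_sq, one_pow, one_mul]
    exact mul_nonneg (h.nonneg _) (by positivity)
  · rw [pow_mul, neg_one_sq, one_pow, one_mul, show 2 * k + 1 + 2 * m = 2 * (k + m) + 1 by ring]
    calc _ ≤ p 1 ^ (k + m + 1) * z ^ (2 * k + 1 + 1 + 2 * m) := by gcongr; exact h.odd_le _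
      _ = _ := by ring
  · rw [pow_succ, pow_mul, neg_one_sq, one_pow, one_mul]
    have := mul_nonneg (h.nonneg (2 * k + 1 + (2 * m + 1)))
      (pow_nonneg hz (2 * k + 1 + 1 + (2 * m + 1)))
    linarith
  · rw [pow_succ (-1 : ℝ), pow_mul, neg_one_sq, one_pow, one_mul,
      show 2 * k + 1 + (2 * m + 1) = 2 * (k + m) + 2 by ring, neg_mul, neg_mul, one_mul]
    refine neg_le_neg ?_
    calc _ ≤ p 1 ^ (k + m + 1) * z ^ (2 * k + 1 + 1 + (2 * m + 1)) := by
          gcongr; exact h.even_le _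
      _ = _ := by ring

lemma altTail_even_bounds {z : ℝ} (hz : 0 ≤ z) (hu : p 1 * z ^ 2 < 1) (k : ℕ) :
    -((p 1 * z ^ 2) ^ (k + 2) / (1 - p 1 * z ^ 2)) ≤ altTail p z (2 * k + 2) ∧
      altTail p z (2 * k + 2) ≤ z * (p 1 * z ^ 2) ^ (k + 1) / (1 - p 1 * z ^ 2) := by
  have ha := h.nonneg 1
  refine tsum_bounds_of_even_odd (h.summable_altTail hz hu _) (by positivity) hu
    (fun m => ?_) (fun m => ?_) (fun m => ?_) (fun m => ?_)
  · rw [pow_mul, neg_one_sq, one_pow, one_mul]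
    exact mul_nonneg (h.nonneg _) (by positivity)
  · rw [pow_mul, neg_one_sq, one_pow, one_mul, show 2 * k + 2 + 2 * m = 2 * (k + m) + 2 by ring]
    calc _ ≤ p 1 ^ (k + m + 1) * z ^ (2 * k + 2 + 1 + 2 * m) := by gcongr; exact h.even_le _
      _ = _ := by ring
  · rw [pow_succ, pow_mul, neg_one_sq, one_pow, one_mul]
    have := mul_nonneg (h.nonneg (2 * k + 2 + (2 * m + 1)))
      (pow_nonneg hz (2 * k + 2 + 1 + (2 * m + 1)))
    linarith
  · rw [pow_succ (-1 : ℝ), pow_mul, neg_one_sq, one_pow, one_mul,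
      show 2 * k + 2 + (2 * m + 1) = 2 * (k + m + 1) + 1 by ring, neg_mul, neg_mul, one_mul]
    refine neg_le_neg ?_
    calc _ ≤ p 1 ^ (k + m + 1 + 1) * z ^ (2 * k + 2 + 1 + (2 * m + 1)) := by
          gcongr; exact h.odd_le _
      _ = _ := by ring

/-- Termwise differentiation of `C(z) = 1 - altTail p z 0`. -/
lemma hasDerivAt_altTail_zero {z : ℝ} (hz : 0 < z) (hu : p 1 * z ^ 2 < 1) :
    HasDerivAt (fun w => altTail p w 0)
      (∑' m : ℕ, (-1) ^ m * p m * ((m + 1) * z ^ m)) z ∧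
      Summable fun m : ℕ => (-1) ^ m * p m * ((m + 1) * z ^ m) := by
  have hr := h.sqrt_mul_lt_one hu
  -- Room to the right of `z`, so that one summable majorant of the derivatives serves a whole
  -- neighbourhood.
  obtain ⟨Z, hzZ, hZ⟩ : ∃ Z, z < Z ∧ √(p 1) * Z < 1 := by
    have hc : Filter.Tendsto (fun w : ℝ => √(p 1) * w) (nhdsWithin z (Set.Ioi z))
        (nhds (√(p 1) * z)) :=
      ((continuous_const.mul continuous_id).tendsto z).mono_left nhdsWithin_le_nhds
    obtain ⟨Z, h1, h2⟩ := ((hc.eventually_lt_const hr).and self_mem_nhdsWithin).exists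
    exact ⟨Z, h2, h1⟩
  have hZ0 : 0 < Z := hz.trans hzZ
  have hbound : Summable fun m : ℕ => ((m : ℝ) + 1) * (√(p 1) * Z) ^ m := by
    have hn : ‖√(p 1) * Z‖ < 1 := by
      rwa [Real.norm_eq_abs, abs_of_nonneg (by positivity)]
    have := (summable_pow_mul_geometric_of_norm_lt_one 1 hn).add
      (summable_geometric_of_norm_lt_one hn)
    refine this.congr fun m => ?_
    ring
  have hle : ∀ m : ℕ, ∀ w ∈ Set.Ioo 0 Z, ‖(-1) ^ m * p m * (((m : ℝ) + 1) * w ^ m)‖ ≤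
      ((m : ℝ) + 1) * (√(p 1) * Z) ^ m := by
    intro m w hw
    rw [norm_mul, norm_mul, norm_pow, norm_neg, norm_one, one_pow, one_mul, Real.norm_eq_abs,
      Real.norm_eq_abs, abs_of_nonneg (h.nonneg _),
      abs_of_nonneg (mul_nonneg (by positivity) (pow_nonneg hw.1.le _))]
    have hw0 := hw.1.le
    calc p m * (((m : ℝ) + 1) * w ^ m) ≤ √(p 1) ^ m * (((m : ℝ) + 1) * Z ^ m) := by
          gcongr
          · exact h.le_sqrt_pow m
          · exact hw.2.le
      _ = _ := by ring
  refine ⟨?_, Summable.of_norm_bounded hbound fun m => hle m z ⟨hz, hzZ⟩⟩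
  refine hasDerivAt_tsum_of_isPreconnected (t := Set.Ioo 0 Z)
    (g := fun m w => (-1) ^ m * p (0 + m) * w ^ (0 + 1 + m))
    (g' := fun m w => (-1) ^ m * p m * (((m : ℝ) + 1) * w ^ m)) hbound isOpen_Ioo
    isPreconnected_Ioo (fun m w _ => ?_) hle ⟨hz, hzZ⟩ (h.summable_altTail hz.le hu 0) ⟨hz, hzZ⟩
  refine ((hasDerivAt_pow (0 + 1 + m) w).const_mul ((-1) ^ m * p (0 + m))).congr_deriv ?_
  rw [show 0 + 1 + m - 1 = m by omega, zero_add, zero_add]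
  push_cast
  ring

/-- Of the positive terms only the constant `1` is kept; the negative ones total at most `2 p₁ z ∑
(m+1) u^m = 2 p₁ z / (1 - u)²` in absolute value, with `u = p₁ z²`. -/
lemma deriv_altTail_zero_pos {z : ℝ} (hz : 0 < z) (hu : p 1 * z ^ 2 < 1)
    (hd : 2 * p 1 * z < (1 - p 1 * z ^ 2) ^ 2) : 0 < deriv (fun w => altTail p w 0) z := by
  obtain ⟨hD, hs⟩ := h.hasDerivAt_altTail_zero hz hu
  rw [hD.deriv]
  have ha := h.nonneg 1
  obtain ⟨g, hg⟩ : ∃ g : ℕ → ℝ, g = fun m : ℕ => (-1) ^ m * p m * ((m + 1) * z ^ m) := ⟨_, rfl⟩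
  rw [← hg] at hs ⊢
  have he : Summable fun m => g (2 * m) := hs.comp_injective (mul_right_injective₀ two_ne_zero)
  have ho : Summable fun m => g (2 * m + 1) :=
    hs.comp_injective (fun a b hab => by simpa using hab)
  rw [← tsum_even_add_odd he ho]
  have e1 : 1 ≤ ∑' m : ℕ, g (2 * m) := by
    have := he.le_tsum 0 fun m _ => by
      simp only [hg, pow_mul, neg_one_sq, one_pow, one_mul]
      exact mul_nonneg (h.nonneg _) (by positivity)
    simpa [hg, h.zero] using this
  have hun : ‖p 1 * z ^ 2‖ < 1 := by rwa [Real.norm_eq_abs, abs_of_nonneg (by positivity)]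
  have hgeo := (hasSum_choose_mul_geometric_of_norm_lt_one 1 hun).mul_left (-(2 * p 1 * z))
  have e2 : -(2 * p 1 * z) * (1 / (1 - p 1 * z ^ 2) ^ (1 + 1)) ≤ ∑' m : ℕ, g (2 * m + 1) := by
    rw [← hgeo.tsum_eq]
    refine hgeo.summable.tsum_le_tsum (fun m => ?_) ho
    simp only [hg]
    rw [pow_succ (-1 : ℝ), pow_mul, neg_one_sq, one_pow, one_mul, neg_mul, neg_mul, neg_mul,
      one_mul, Nat.choose_one_right]
    refine neg_le_neg ?_
    calc _ ≤ p 1 ^ (m + 1) * (((2 * m + 1 : ℕ) + 1) * z ^ (2 * m + 1)) := by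
          gcongr; exact h.odd_le _
      _ = _ := by push_cast; ring
  have hpos : 0 < (1 - p 1 * z ^ 2) ^ 2 := by
    have : 0 < 1 - p 1 * z ^ 2 := by linarith
    positivity
  have e3 : 2 * p 1 * z * (1 / (1 - p 1 * z ^ 2) ^ (1 + 1)) < 1 := by
    rw [mul_one_div, div_lt_one hpos]
    exact hd
  linarith

end IsExceedance

end Tails

/-! ### Existence, uniqueness and location of the zero -/

section Zero

namespace IsExceedance

variable {p : ℕ → ℝ} (h : IsExceedance p)
include h

lemma altTail_zero_one_lt (hpos : 0 < p 1) (hle : p 1 ≤ 0.1) (h2 : 2 * p 2 ≤ p 1 + p 3) :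
    altTail p 1 0 < 1 := by
  have hu : p 1 * (1 : ℝ) ^ 2 < 1 := by norm_num at hle ⊢; linarith
  have e0 := h.altTail_eq zero_le_one hu 0
  have e1 := h.altTail_eq zero_le_one hu 1
  have e2 := h.altTail_eq zero_le_one hu 2
  have e3 := (h.altTail_odd_bounds zero_le_one hu 1).1
  have h3 := h.odd_le 1
  norm_num [h.zero] at e0 e1 e2 e3 h3
  have e4 : p 1 ^ 2 / (1 - p 1) ≤ 1 / 9 * p 1 := by
    rw [div_le_iff₀ (by linarith)]
    nlinarith
  have : p 1 ^ 2 ≤ 1 / 10 * p 1 := by nlinarith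
  linarith

/-- With `u = p₁ W²` the first tail is at most `u / (1 - u)`, which is below `W - 1` exactly when `u
W < W - 1`: this is where the cubic comes from. -/
lemma lt_altTail_zero {W : ℝ} (hW : 1 < W) (hu : p 1 * W ^ 2 < 1)
    (hW3 : p 1 * W ^ 3 < W - 1) : 1 < altTail p W 0 := by
  have e0 := h.altTail_eq (by linarith) hu 0
  have e1 := (h.altTail_odd_bounds (by linarith) hu 0).2
  simp only [h.zero, mul_zero, zero_add, pow_one, one_mul] at e0 e1
  have : p 1 * W ^ 2 / (1 - p 1 * W ^ 2) < W - 1 := by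
    rw [div_lt_iff₀ (by linarith)]
    nlinarith
  linarith

lemma exists_unique_zero (hpos : 0 < p 1) (hle : p 1 ≤ 0.1) (h2 : 2 * p 2 ≤ p 1 + p 3) {W : ℝ}
    (hW : 1 < W) (hu : p 1 * W ^ 2 < 0.18) (hW3 : p 1 * W ^ 3 < W - 1) :
    ∃ lam ∈ Set.Ioo 1 W, altTail p lam 0 = 1 ∧ 0 < deriv (fun w => altTail p w 0) lam ∧
      ∀ z ∈ Set.Ioo 1 W, altTail p z 0 = 1 → z = lam := by
  have hu' : ∀ z ∈ Set.Icc 1 W, p 1 * z ^ 2 < 0.18 := fun z hz => lt_of_le_of_lt (by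
    have := hz.1
    gcongr
    exact hz.2) hu
  have hlt : ∀ z ∈ Set.Icc 1 W, p 1 * z ^ 2 < 1 := fun z hz => (hu' z hz).trans (by norm_num)
  have hd : ∀ z ∈ Set.Icc 1 W, 0 < deriv (fun w => altTail p w 0) z := by
    intro z hz
    refine h.deriv_altTail_zero_pos (by linarith [hz.1]) (hlt z hz) ?_
    have h1 := hu' z hz
    have h3 : p 1 * z ≤ p 1 * z ^ 2 :=
      mul_le_mul_of_nonneg_left (le_self_pow₀ hz.1 two_ne_zero) hpos.le
    norm_num at h1
    nlinarith
  have hc : ContinuousOn (fun w => altTail p w 0) (Set.Icc 1 W) := fun z hz =>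
    (h.hasDerivAt_altTail_zero (by linarith [hz.1]) (hlt z hz)).1.continuousAt.continuousWithinAt
  have hmono : StrictMonoOn (fun w => altTail p w 0) (Set.Icc 1 W) :=
    strictMonoOn_of_deriv_pos (convex_Icc 1 W) hc fun z hz => hd z (interior_subset hz)
  obtain ⟨lam, hlam, hl1⟩ := intermediate_value_Ioo hW.le hc
    ⟨h.altTail_zero_one_lt hpos hle h2,
      h.lt_altTail_zero hW (hu.trans (by norm_num)) hW3⟩
  refine ⟨lam, hlam, hl1, hd lam (Set.Ioo_subset_Icc_self hlam), fun z hz hz1 => ?_⟩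
  exact hmono.injOn (Set.Ioo_subset_Icc_self hz) (Set.Ioo_subset_Icc_self hlam)
    (hz1.trans hl1.symm)

lemma zero_sub_one_le {z : ℝ} (hz : 1 < z) (hu : p 1 * z ^ 2 < 1) (h0 : altTail p z 0 = 1) :
    z - 1 ≤ p 1 * z ^ 3 := by
  by_contra! hcon
  exact (h.lt_altTail_zero hz hu hcon).ne' h0

end IsExceedance

/-- If `z - 1 ≤ a z ^ 3` with `z` below the turning point of the cubic, then `z` is at most its
smallest positive root; here that root is bounded for `a ≤ 0.1`. -/
lemma sub_one_le_of_cubic {a z : ℝ} (ha : 0 < a) (hle : a ≤ 0.1) (hz : 1 < z)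
    (hu : a * z ^ 2 < 0.18) (h : z - 1 ≤ a * z ^ 3) : z - 1 ≤ 1.54 * a := by
  by_contra! hcon
  -- `1.54` slightly exceeds `1.154 ^ 3`, so the cubic `a w³ - w + 1` is nonpositive at `w`; it
  -- decreases from `w` to `z` because `3 a z² < 1`.
  set w := 1 + 1.54 * a with hw
  have hwz : w < z := by linarith
  have hw1 : w ≤ 1.154 := by norm_num at *; linarith
  have hw0 : 1 < w := by norm_num at *; linarith
  have hw3 : w ^ 3 ≤ 1.154 ^ 3 := by gcongr
  have h1 : a * w ^ 3 ≤ w - 1 := by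
    have : a * w ^ 3 ≤ a * 1.54 := by
      gcongr
      exact hw3.trans (by norm_num)
    linarith
  have h2 : a * (z ^ 2 + z * w + w ^ 2) ≤ 3 * (a * z ^ 2) := by
    have : z ^ 2 + z * w + w ^ 2 ≤ 3 * z ^ 2 := by nlinarith
    nlinarith
  norm_num at hu
  have h3 : 0 < (z - w) * (1 - a * (z ^ 2 + z * w + w ^ 2)) := mul_pos (by linarith) (by linarith)
  nlinarith

/-- Two nonpositive roots `s < t` would give `α (t² + t s + s²) = 1`, so `α t² ≤ 1` and `α t³ - t +
1 ≥ 1`. -/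
lemma IsSecondRoot.pos {α t : ℝ} (hα : 0 < α) (h : IsSecondRoot α t) : 0 < t := by
  obtain ⟨h1, ⟨s, hs, h2⟩, -⟩ := h
  simp only [IsRootCubic] at h1 h2
  by_contra! ht
  have h3 : α * (t ^ 2 + t * s + s ^ 2) = 1 := by
    have : (t - s) * (α * (t ^ 2 + t * s + s ^ 2) - 1) = 0 := by linear_combination h1 - h2
    rcases mul_eq_zero.1 this with h | h <;> linarith
  have hts : 0 ≤ t * s := mul_nonneg_of_nonpos_of_nonpos ht (hs.le.trans ht)
  have h4 : α * t ^ 2 ≤ 1 := by nlinarith [sq_nonneg s]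
  nlinarith

/-- With `w = α η²` one has `η² ≥ 10 w`, and positivity of the bracket forces `(1 - w)² > w (2.6 +
6.4 w)`; this already fails at `w = 0.18`. -/
lemma mul_eta_sq_lt {α l : ℝ} (hα : 0 < α) (hle : α ≤ 0.1) (hl : 0 < l)
    (hbr : 0 < bracketE α l) : α * eta α l ^ 2 < 0.18 := by
  have hη : 1 ≤ eta α l := by simp only [eta]; nlinarith
  simp only [bracketE] at hbr
  set η := eta α l
  by_contra! hw
  have hw0 : 0 < α * η ^ 2 := by positivity
  norm_num at hle hw
  have h1 : 10 * (α * η ^ 2) ≤ η ^ 2 := by nlinarith [sq_nonneg η]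
  have h2 : 1 + 0.8 * η ≤ 1 + η - 2 * α * η := by norm_num; nlinarith
  have h3 : 2.6 + 6.4 * (α * η ^ 2) ≤ (1 + η - 2 * α * η) ^ 2 := by
    calc _ ≤ (1 + 0.8 * η) ^ 2 := by norm_num; nlinarith
      _ ≤ _ := by gcongr
  have h4 : α * η ^ 2 * (2.6 + 6.4 * (α * η ^ 2)) ≤ α * η ^ 2 * (1 + η - 2 * α * η) ^ 2 := by
    gcongr
  norm_num at h4
  nlinarith

/-- `l > t₂³` implies that `l` exceeds the cube of `1 + l a` for every `0 < a ≤ α`. -/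
lemma cube_lt_of_isSecondRoot {α l t : ℝ} (hα : 0 < α) (ht : IsSecondRoot α t) (hl : t ^ 3 < l)
    (hu : α * eta α l ^ 2 < 0.18) : eta α l ^ 3 < l := by
  have ht0 := ht.pos hα
  have h1 := ht.1
  simp only [IsRootCubic] at h1
  have hη : eta α l - 1 = l * α := by simp only [eta]; ring
  set η := eta α l
  -- `η - 1 = l α > α t³ = t - 1`. The cubic decreases from `t` to `η`, hence is negative at `η`,
  -- that is, `α η³ < η - 1 = α l`.
  have htη : t < η := by nlinarith
  have h2 : α * (η ^ 2 + η * t + t ^ 2) ≤ 3 * (α * η ^ 2) := by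
    have : η ^ 2 + η * t + t ^ 2 ≤ 3 * η ^ 2 := by nlinarith
    nlinarith
  norm_num at hu
  have h3 : 0 < (η - t) * (1 - α * (η ^ 2 + η * t + t ^ 2)) :=
    mul_pos (by linarith) (by linarith)
  have h4 : α * η ^ 3 < α * l := by nlinarith
  exact lt_of_mul_lt_mul_left h4 hα.le

lemma IsSecondRoot.one_lt {α t : ℝ} (hα : 0 < α) (h : IsSecondRoot α t) : 1 < t := by
  have ht := h.pos hα
  have h1 := h.1
  simp only [IsRootCubic] at h1
  have : 0 < α * t ^ 3 := by positivity
  linarith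

end Zero

/-! ### Crude lower bound for the coefficient `Γ(α)` -/

section Gamma

lemma fifteen_le_coeffK {α l : ℝ} (hα : 0 < α) (hle : α ≤ 0.1) (hl : 1 < l)
    (hu : α * eta α l ^ 2 < 0.18) : 15 ≤ coeffK α l := by
  have hη : 1 ≤ eta α l := by simp only [eta]; nlinarith
  have hdef : 1 + l * α = eta α l := rfl
  simp only [coeffK, hdef]
  have hlα : l * α = eta α l - 1 := by rw [← hdef]; ring
  set η := eta α l
  norm_num at hle hu
  have hw0 : 0 < α * η ^ 2 := by positivity
  have hA : 11 ≤ (11 - 3 * α) / (1 - α) ^ 2 := by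
    rw [le_div_iff₀ (by have : 0 < 1 - α := by linarith
                        positivity)]
    nlinarith
  have hd : 0 < 1 - α * η ^ 2 := by linarith
  have hB : 2 ≤ (2 + 3 * l * α - α * (2 - l * α) * η ^ 2) / (1 - α * η ^ 2) ^ 3 := by
    rw [le_div_iff₀ (by positivity)]
    have h1 : (1 - α * η ^ 2) ^ 3 ≤ 1 - α * η ^ 2 := by
      have := pow_le_of_le_one hd.le (by linarith) (three_ne_zero)
      exact this
    have h2 : 0 < l * α := by positivity
    nlinarith [mul_pos h2 hw0]
  have hB' : 4 ≤ 2 * l * (1 + 3 * α) *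
      ((2 + 3 * l * α - α * (2 - l * α) * η ^ 2) / (1 - α * η ^ 2) ^ 3) := by
    have : 2 ≤ 2 * l * (1 + 3 * α) := by nlinarith
    nlinarith
  have hE : 2 * α * η / (1 - α * η ^ 2) ^ 2 < 1 := by
    rw [div_lt_one (by positivity)]
    have : α * η ≤ α * η ^ 2 := by nlinarith
    nlinarith
  have hE0 : 0 ≤ 2 * α * η / (1 - α * η ^ 2) ^ 2 := by positivity
  rw [le_div_iff₀ (by linarith)]
  nlinarith

lemma hundred_le_coeffL {α l : ℝ} (hα : 0 < α) (hK : 15 ≤ coeffK α l) : 100 ≤ coeffL α l := by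
  simp only [coeffL]
  set K := coeffK α l
  have h1 : 45 ≤ 3 * K * (1 + α + 3 * α ^ 2) * (1 + α + 3 * α ^ 2 + K * α ^ 3) := by
    calc (45 : ℝ) = 3 * 15 * 1 * 1 := by norm_num
      _ ≤ _ := by
        gcongr
        · nlinarith
        · have : 0 ≤ K * α ^ 3 := by positivity
          nlinarith
  have h2 : 0 ≤ α ^ 6 * K ^ 3 := by positivity
  have h3 : 0 ≤ 9 * α * (4 + 3 * α + 3 * α ^ 2) := by positivity
  linarith

lemma twelve_le_coeffE {α l : ℝ} (hα : 0 < α) (hle : α ≤ 0.1) (hl : 1 < l)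
    (hu : α * eta α l ^ 2 < 0.18) (hbr : 0 < bracketE α l) : 12 ≤ coeffE α l := by
  have hη : 1 ≤ eta α l := by simp only [eta]; nlinarith
  have hbr1 : bracketE α l ≤ 1 := by
    simp only [bracketE]
    have : 0 ≤ α * eta α l ^ 2 := by positivity
    norm_num at hu
    have h2 : 0 ≤ α * eta α l ^ 2 * (1 + eta α l - 2 * α * eta α l) ^ 2 := by positivity
    nlinarith
  simp only [coeffE]
  set η := eta α l
  norm_num at hle hu
  have hw0 : 0 < α * η ^ 2 := by positivity
  have hd : 0 < 1 - α * η ^ 2 := by linarith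
  have hden : 2 * (1 - α * η ^ 2) ^ 4 * bracketE α l ≤ 2 := by
    calc _ ≤ 2 * (1 : ℝ) ^ 4 * 1 := by gcongr; linarith
      _ = 2 := by norm_num
  have hnum : (24 : ℝ) ≤ η ^ 5 * (1 + (1 - 2 * α) * η) ^ 4 * (1 + α * (η - 2)) *
      (1 + η + (1 - 3 * α) * η ^ 2) := by
    have f1 : 1.8 ≤ 1 + (1 - 2 * α) * η := by norm_num; nlinarith
    have f2 : 0.9 ≤ 1 + α * (η - 2) := by norm_num; nlinarith
    have f3 : 2.7 ≤ 1 + η + (1 - 3 * α) * η ^ 2 := by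
      have : 0.7 * 1 ≤ (1 - 3 * α) * η ^ 2 :=
        mul_le_mul (by norm_num; linarith) (one_le_pow₀ hη) zero_le_one (by linarith)
      norm_num at this ⊢
      linarith
    have f0 : (1 : ℝ) ≤ η ^ 5 := one_le_pow₀ hη
    have f4 : (1.8 : ℝ) ^ 4 ≤ (1 + (1 - 2 * α) * η) ^ 4 := pow_le_pow_left₀ (by norm_num) f1 4
    have g1 := mul_le_mul f0 f4 (by norm_num) (by linarith)
    have g2 := mul_le_mul g1 f2 (by norm_num) ((by norm_num : (0 : ℝ) ≤ 1 * 1.8 ^ 4).trans g1)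
    have g3 := mul_le_mul g2 f3 (by norm_num)
      ((by norm_num : (0 : ℝ) ≤ 1 * 1.8 ^ 4 * 0.9).trans g2)
    exact (by norm_num : (24 : ℝ) ≤ 1 * 1.8 ^ 4 * 0.9 * 2.7).trans g3
  have : 12 ≤ η ^ 5 * (1 + (1 - 2 * α) * η) ^ 4 * (1 + α * (η - 2)) *
      (1 + η + (1 - 3 * α) * η ^ 2) / (2 * (1 - α * η ^ 2) ^ 4 * bracketE α l) := by
    rw [le_div_iff₀ (by positivity)]
    linarith
  norm_num
  linarith

lemma coeffGamma_lower {α l : ℝ} (hα : 0 < α) (hle : α ≤ 0.1) (hl : 1 < l)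
    (hu : α * eta α l ^ 2 < 0.18) (hbr : 0 < bracketE α l) : 112 ≤ coeffGamma α l := by
  have := hundred_le_coeffL hα (fifteen_le_coeffK hα hle hl hu)
  have := twelve_le_coeffE hα hle hl hu hbr
  simp only [coeffGamma]
  linarith

end Gamma

/-! ### Renewal equations and inverse power series -/

section Renewal

open Finset

/-- Summation by parts for a pair of mutually inverse power series. -/
lemma sum_antidiagonal_partialSum_mul_diff {c r y : ℕ → ℝ}
    (hcr : ∀ n, ∑ ij ∈ antidiagonal n, c ij.1 * r ij.2 = if n = 0 then 1 else 0)
    (hy0 : y 0 = r 0) (hy : ∀ n, y (n + 1) = r (n + 1) - r n) (n : ℕ) :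
    ∑ ij ∈ antidiagonal n, (∑ k ∈ range (ij.1 + 1), c k) * y ij.2 = if n = 0 then 1 else 0 := by
  have h1 : PowerSeries.mk c * PowerSeries.mk r = 1 := by
    ext n
    rw [PowerSeries.coeff_mul, PowerSeries.coeff_one, ← hcr]
    simp
  have h2 : (1 - PowerSeries.X) * PowerSeries.mk r = PowerSeries.mk y := by
    ext n
    rw [sub_mul, one_mul, map_sub]
    rcases n with _ | n
    · simp [hy0]
    · rw [PowerSeries.coeff_succ_X_mul]
      simp [hy]
  have h3 : (1 - PowerSeries.X) * PowerSeries.mk (fun n => ∑ k ∈ range (n + 1), c k) =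
      PowerSeries.mk c := by
    ext n
    rw [sub_mul, one_mul, map_sub]
    rcases n with _ | n
    · simp
    · rw [PowerSeries.coeff_succ_X_mul]
      simp [sum_range_succ _ (n + 1)]
  have h4 : PowerSeries.mk (fun n => ∑ k ∈ range (n + 1), c k) * PowerSeries.mk y = 1 := by
    calc _ = (1 - PowerSeries.X) * PowerSeries.mk (fun n => ∑ k ∈ range (n + 1), c k) *
          PowerSeries.mk r := by rw [← h2]; ring
      _ = 1 := by rw [h3, h1]
  have h5 := congrArg (PowerSeries.coeff n) h4
  rw [PowerSeries.coeff_mul, PowerSeries.coeff_one] at h5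
  simpa using h5

lemma sum_range_sum_antidiagonal_le {f g : ℕ → ℝ} (hf : ∀ n, 0 ≤ f n) (hg : ∀ n, 0 ≤ g n)
    (N : ℕ) : ∑ n ∈ range N, ∑ ij ∈ antidiagonal n, f ij.1 * g ij.2 ≤
      (∑ i ∈ range N, f i) * ∑ j ∈ range N, g j := by
  simp only [Nat.sum_antidiagonal_eq_sum_range_succ (fun i j => f i * g j),
    Nat.succ_eq_add_one]
  rw [sum_range_diag_flip N fun i j => f i * g j, sum_mul]
  refine sum_le_sum fun i _ => ?_
  rw [← mul_sum]
  exact mul_le_mul_of_nonneg_left (sum_le_sum_of_subset_of_nonneg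
    (range_mono (Nat.sub_le _ _)) fun j _ _ => hg j) (hf i)

lemma sum_range_shift_le {f : ℕ → ℝ} (hf : ∀ n, 0 ≤ f n) (N k : ℕ) :
    ∑ n ∈ range N, f (n + k) ≤ f k + ∑ n ∈ range N, f (n + (k + 1)) := by
  calc _ ≤ ∑ n ∈ range (N + 1), f (n + k) :=
        sum_le_sum_of_subset_of_nonneg (range_mono (Nat.le_succ N)) fun j _ _ => hf _
    _ = _ := by
      rw [sum_range_succ', zero_add, add_comm]
      congr 1
      exact sum_congr rfl fun n _ => by rw [show n + 1 + k = n + (k + 1) by ring]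

lemma renewal_first_terms {β y : ℕ → ℝ} (hβ0 : β 0 = 1) (hy0 : y 0 = 1)
    (h : ∀ n, ∑ ij ∈ antidiagonal n, β ij.1 * y ij.2 = if n = 0 then 1 else 0) :
    y 1 = -β 1 ∧ y 2 = -(β 1 * y 1 + β 2) ∧ y 3 = -(β 1 * y 2 + β 2 * y 1 + β 3) ∧
      y 4 = -(β 1 * y 3 + β 2 * y 2 + β 3 * y 1 + β 4) := by
  have h1 := h 1
  have h2 := h 2
  have h3 := h 3
  have h4 := h 4
  simp [Nat.sum_antidiagonal_succ, hβ0, hy0] at h1 h2 h3 h4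
  refine ⟨?_, ?_, ?_, ?_⟩ <;> linarith

/-- The tail of the solution of a renewal equation, in terms of bounds on its first terms. -/
lemma renewal_tail_le {β y : ℕ → ℝ} (hβ0 : β 0 = 1)
    (h : ∀ n, ∑ ij ∈ antidiagonal n, β ij.1 * y ij.2 = if n = 0 then 1 else 0)
    {B : ℝ} (hB : ∀ N, ∑ i ∈ range N, |β (i + 5)| ≤ B) (N : ℕ) :
    (∑ n ∈ range N, |y (n + 5)|) * (1 - (|β 1| + |β 2| + |β 3| + |β 4| + B)) ≤
      |β 1| * |y 4| + |β 2| * (|y 3| + |y 4|) + |β 3| * (|y 2| + |y 3| + |y 4|) +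
        |β 4| * (|y 1| + |y 2| + |y 3| + |y 4|) +
        B * (|y 0| + |y 1| + |y 2| + |y 3| + |y 4|) := by
  have hstep : ∀ n, |y (n + 5)| ≤ |β 1| * |y (n + 4)| + |β 2| * |y (n + 3)| +
      |β 3| * |y (n + 2)| + |β 4| * |y (n + 1)| +
      ∑ ij ∈ antidiagonal n, |β (ij.1 + 5)| * |y ij.2| := by
    -- The equation at index `n + 5` is solved for `y (n + 5)`, with `β 1, …, β 4` split off and all
    -- later coefficients kept in one convolution.
    intro n
    have h5 := h (n + 5)
    simp only [Nat.sum_antidiagonal_succ, hβ0] at h5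
    have e : y (n + 5) = -(β 1 * y (n + 4)) + -(β 2 * y (n + 3)) + -(β 3 * y (n + 2)) +
        -(β 4 * y (n + 1)) + -∑ ij ∈ antidiagonal n, β (ij.1 + 5) * y ij.2 := by
      simp at h5
      linarith
    rw [e]
    simp only [← abs_mul]
    refine (abs_add_le _ _).trans (add_le_add ((abs_add_le _ _).trans (add_le_add
      ((abs_add_le _ _).trans (add_le_add ((abs_add_le _ _).trans ?_) ?_)) ?_)) ?_)
    · rw [abs_neg, abs_neg]
    · rw [abs_neg]
    · rw [abs_neg]
    · rw [abs_neg]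
      exact abs_sum_le_sum_abs _ _
  set S := ∑ n ∈ range N, |y (n + 5)| with hS
  have hy : ∀ n, 0 ≤ |y n| := fun n => abs_nonneg _
  have s4 := sum_range_shift_le hy N 4
  have s3 := sum_range_shift_le hy N 3
  have s2 := sum_range_shift_le hy N 2
  have s1 := sum_range_shift_le hy N 1
  have s0 := sum_range_shift_le hy N 0
  simp only [Nat.reduceAdd, add_zero] at s0 s1 s2 s3 s4
  have hconv : ∑ n ∈ range N, ∑ ij ∈ antidiagonal n, |β (ij.1 + 5)| * |y ij.2| ≤
      B * (|y 0| + |y 1| + |y 2| + |y 3| + |y 4| + S) := by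
    refine (sum_range_sum_antidiagonal_le (f := fun i => |β (i + 5)|) (g := fun i => |y i|)
      (fun n => abs_nonneg _) hy N).trans ?_
    refine mul_le_mul (hB N) (by linarith) (sum_nonneg fun n _ => hy n) ?_
    exact (sum_nonneg fun n _ => abs_nonneg _).trans (hB N)
  have hsum := sum_le_sum fun n (_ : n ∈ range N) => hstep n
  simp only [sum_add_distrib, ← mul_sum] at hsum
  -- Each shifted sum is at most a few initial terms plus `S`; the multiples of `S` are absorbed
  -- into the left side.
  have m1 := mul_le_mul_of_nonneg_left s4 (abs_nonneg (β 1))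
  have m2 := mul_le_mul_of_nonneg_left (s3.trans (add_le_add_right s4 _)) (abs_nonneg (β 2))
  have m3 := mul_le_mul_of_nonneg_left
    (s2.trans (add_le_add_right (s3.trans (add_le_add_right s4 _)) _)) (abs_nonneg (β 3))
  have m4 := mul_le_mul_of_nonneg_left (s1.trans (add_le_add_right
    (s2.trans (add_le_add_right (s3.trans (add_le_add_right s4 _)) _)) _)) (abs_nonneg (β 4))
  rw [← hS] at hsum m1 m2 m3 m4
  linarith

lemma sum_range_pow_half_le {u : ℝ} (hu : 0 ≤ u) (hu1 : u < 1) (N : ℕ) :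
    ∑ i ∈ range N, u ^ (i / 2) ≤ 2 / (1 - u) := by
  have h1 : ∀ M : ℕ, ∑ i ∈ range (2 * M), u ^ (i / 2) = 2 * ∑ i ∈ range M, u ^ i := by
    intro M
    induction M with
    | zero => simp
    | succ M ih =>
      rw [show 2 * (M + 1) = 2 * M + 1 + 1 by ring, sum_range_succ, sum_range_succ, ih,
        sum_range_succ, show 2 * M / 2 = M by omega, show (2 * M + 1) / 2 = M by omega]
      ring
  calc _ ≤ ∑ i ∈ range (2 * N), u ^ (i / 2) := by
        refine sum_le_sum_of_subset_of_nonneg (range_mono (by omega)) fun j _ _ => ?_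
        positivity
    _ = 2 * ∑ i ∈ range N, u ^ i := h1 N
    _ ≤ 2 * (1 - u)⁻¹ := by
      gcongr
      rw [← tsum_geometric_of_lt_one hu hu1]
      exact (summable_geometric_of_lt_one hu hu1).sum_le_tsum _ fun i _ => by positivity
    _ = _ := by ring

end Renewal

/-! ### Numerical estimates for the first terms -/

section Estimates

/-- The relations between the first exceedance probabilities `a, b, c, d`, the zero `1 + δ` of the
generating function, and the first tails `s, t₃, t₄, T` of the series at this zero. -/
structure TailData (a b c d δ s t₃ t₄ T : ℝ) : Prop where
  a_pos : 0 < a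
  a_le : a ≤ 1 / 10
  d_nonneg : 0 ≤ d
  d_le : d ≤ c
  c_le : c ≤ a ^ 2
  two_b_le : 2 * b ≤ a + c
  b_nonneg : 0 ≤ b
  δ_pos : 0 < δ
  δ_le : δ ≤ 1.54 * a
  δ_le_cube : δ ≤ a * (1 + δ) ^ 3
  s_eq : s = b * (1 + δ) ^ 3 - t₃
  t₃_eq : t₃ = c * (1 + δ) ^ 4 - t₄
  t₄_eq : t₄ = d * (1 + δ) ^ 5 - T
  T_lower : -(3.15 * a ^ 3) ≤ T
  T_upper : T ≤ 2.73 * a ^ 3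

namespace TailData

variable {a b c d δ s t₃ t₄ T : ℝ} (h : TailData a b c d δ s t₃ t₄ T)
include h

/-- Trades surplus powers of `a` for a factor `1/10`, so that the estimates below become linear in
the monomials. -/
lemma pow_le (n : ℕ) : a ^ (n + 1) ≤ 1 / 10 * a ^ n := by
  rw [pow_succ, mul_comm]
  exact mul_le_mul_of_nonneg_right h.a_le (pow_nonneg h.a_pos.le n)

lemma one_add_pow_le (n : ℕ) : (1 + δ) ^ n ≤ (1 + 1.54 * a) ^ n := by
  have := h.δ_pos
  have := h.δ_le
  gcongr

lemma cube_le : (1 + δ) ^ 3 ≤ 1 + 5.37 * a := by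
  have h1 := h.one_add_pow_le 3
  have := h.a_pos
  have e1 := h.pow_le 1
  have e2 := h.pow_le 2
  norm_num at *
  linarith

lemma pow_four_le : (1 + δ) ^ 4 ≤ 1 + 7.74 * a := by
  have h1 := h.one_add_pow_le 4
  have := h.a_pos
  have e1 := h.pow_le 1
  have e2 := h.pow_le 2
  have e3 := h.pow_le 3
  norm_num at *
  linarith

lemma pow_five_le : (1 + δ) ^ 5 ≤ 1 + 10.47 * a := by
  have h1 := h.one_add_pow_le 5
  have := h.a_pos
  have e1 := h.pow_le 1
  have e2 := h.pow_le 2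
  have e3 := h.pow_le 3
  have e4 := h.pow_le 4
  norm_num at *
  linarith

/-- Feeding the rough bound back into `δ ≤ a (1 + δ)³` gives leading coefficient 1, which the final
constant 3 requires. -/
lemma δ_le_quadratic : δ ≤ a + 5.37 * a ^ 2 := by
  have := mul_le_mul_of_nonneg_left h.cube_le h.a_pos.le
  have := h.δ_le_cube
  linarith

lemma t₄_bounds : -(2.73 * a ^ 3) ≤ t₄ ∧ t₄ ≤ a ^ 2 + 13.62 * a ^ 3 := by
  have h1 : d * (1 + δ) ^ 5 ≤ a ^ 2 * (1 + 10.47 * a) :=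
    mul_le_mul (h.d_le.trans h.c_le) h.pow_five_le
      (pow_nonneg (by linarith [h.δ_pos]) _) (sq_nonneg a)
  have h2 : 0 ≤ d * (1 + δ) ^ 5 :=
    mul_nonneg h.d_nonneg (pow_nonneg (by linarith [h.δ_pos]) _)
  have := h.t₄_eq
  have := h.T_lower
  have := h.T_upper
  constructor <;> linarith

lemma t₃_bounds : -(5.89 * a ^ 3) ≤ t₃ ∧ t₃ ≤ a ^ 2 + 10.47 * a ^ 3 := by
  have hL : 0 ≤ 1 + δ := by linarith [h.δ_pos]
  have hc : 0 ≤ c := h.d_nonneg.trans h.d_le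
  have h1 : c * (1 + δ) ^ 4 ≤ a ^ 2 * (1 + 7.74 * a) :=
    mul_le_mul h.c_le h.pow_four_le (pow_nonneg hL _) (sq_nonneg a)
  have h2 : 0 ≤ d * (1 + δ) ^ 5 := mul_nonneg h.d_nonneg (pow_nonneg hL _)
  -- Since `d ≤ c`, the difference `c (1 + δ)⁴ - d (1 + δ)⁵` is at least `-c (1 + δ)⁴ δ`, so `t₃` is
  -- negative only to third order.
  have h3 : d * (1 + δ) ^ 5 ≤ c * (1 + δ) ^ 5 :=
    mul_le_mul_of_nonneg_right h.d_le (pow_nonneg hL _)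
  have h4 : c * (1 + δ) ^ 4 * δ ≤ a ^ 2 * (1 + 7.74 * a) * (1.54 * a) :=
    mul_le_mul h1 h.δ_le h.δ_pos.le (by have := h.a_pos; positivity)
  have e3 := h.pow_le 3
  have := h.t₄_eq
  have := h.t₃_eq
  have := h.T_lower
  have := h.T_upper
  have ha3 : 0 < a ^ 3 := pow_pos h.a_pos 3
  norm_num at *
  constructor <;> linarith

lemma b_le : b ≤ 0.55 * a := by
  have := h.two_b_le
  have := h.c_le
  have e1 := h.pow_le 1
  norm_num at *
  linarith

lemma s_bounds : -(2.05 * a ^ 2) ≤ s ∧ s ≤ 0.905 * a := by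
  have hL : 0 ≤ 1 + δ := by linarith [h.δ_pos]
  have h1 : b * (1 + δ) ^ 3 ≤ 0.55 * a * (1 + 5.37 * a) :=
    mul_le_mul h.b_le h.cube_le (pow_nonneg hL _) (by have := h.a_pos; positivity)
  have h2 : 0 ≤ b * (1 + δ) ^ 3 := mul_nonneg h.b_nonneg (pow_nonneg hL _)
  obtain ⟨h3, h4⟩ := h.t₃_bounds
  have := h.s_eq
  have := h.a_pos
  have e1 := h.pow_le 1
  have e2 := h.pow_le 2
  norm_num at *
  constructor <;> linarith

lemma abs_s_le : |s| ≤ 0.905 * a := by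
  obtain ⟨h1, h2⟩ := h.s_bounds
  have := h.a_pos
  have e1 := h.pow_le 1
  norm_num at *
  exact abs_le.2 ⟨by linarith, h2⟩

lemma abs_t₃_le : |t₃| ≤ 2.05 * a ^ 2 := by
  obtain ⟨h1, h2⟩ := h.t₃_bounds
  have := pow_pos h.a_pos 2
  have e1 := h.pow_le 2
  norm_num at *
  exact abs_le.2 ⟨by linarith, by linarith⟩

lemma abs_t₄_le : |t₄| ≤ 2.362 * a ^ 2 := by
  obtain ⟨h1, h2⟩ := h.t₄_bounds
  have := pow_pos h.a_pos 2
  have e1 := h.pow_le 2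
  norm_num at *
  exact abs_le.2 ⟨by linarith, by linarith⟩

lemma sq_le : δ ^ 2 ≤ 2.372 * a ^ 2 := by
  have : δ ^ 2 ≤ (1.54 * a) ^ 2 := pow_le_pow_left₀ h.δ_pos.le h.δ_le 2
  have := pow_pos h.a_pos 2
  norm_num at *
  linarith

lemma δ_cube_le : δ ^ 3 ≤ 3.66 * a ^ 3 := by
  have : δ ^ 3 ≤ (1.54 * a) ^ 3 := pow_le_pow_left₀ h.δ_pos.le h.δ_le 3
  have := pow_pos h.a_pos 3
  norm_num at *
  linarith

lemma δ_mul_s_bounds : -(3.16 * a ^ 3) ≤ δ * s ∧ δ * s ≤ 1.394 * a ^ 2 := by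
  obtain ⟨h1, h2⟩ := h.s_bounds
  have hδ := h.δ_pos
  have ha := h.a_pos
  have h3 : δ * s ≤ 1.54 * a * (0.905 * a) := by
    calc δ * s ≤ δ * (0.905 * a) := by gcongr
      _ ≤ _ := by gcongr; exact h.δ_le
  have h4 : δ * (2.05 * a ^ 2) ≤ 1.54 * a * (2.05 * a ^ 2) := by gcongr; exact h.δ_le
  have h5 : δ * -(2.05 * a ^ 2) ≤ δ * s := by gcongr
  have := pow_pos h.a_pos 2
  have := pow_pos h.a_pos 3
  norm_num at *
  constructor <;> linarith

lemma abs_y₂_le : |δ ^ 2 - s| ≤ 0.905 * a := by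
  obtain ⟨h1, h2⟩ := h.s_bounds
  have h3 := h.sq_le
  have := h.a_pos
  have e1 := h.pow_le 1
  have := sq_nonneg δ
  norm_num at *
  exact abs_le.2 ⟨by linarith, by linarith⟩

lemma abs_y₃_le : |δ ^ 3 - 2 * (δ * s) + t₃| ≤ 3.38 * a ^ 2 := by
  obtain ⟨h1, h2⟩ := h.t₃_bounds
  obtain ⟨h3, h4⟩ := h.δ_mul_s_bounds
  have h5 := h.δ_cube_le
  have h6 := pow_pos h.δ_pos 3
  have := pow_pos h.a_pos 2
  have e1 := h.pow_le 2
  norm_num at *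
  exact abs_le.2 ⟨by linarith, by linarith⟩

lemma abs_mul_y₃_le : |δ * (δ ^ 3 - 2 * (δ * s) + t₃)| ≤ 5.21 * a ^ 3 := by
  rw [abs_mul, abs_of_pos h.δ_pos]
  have ha := h.a_pos
  calc _ ≤ 1.54 * a * (3.38 * a ^ 2) := by
        gcongr
        · exact h.δ_le
        · exact h.abs_y₃_le
    _ = 5.2052 * a ^ 3 := by ring
    _ ≤ _ := by gcongr; norm_num

lemma abs_y₄_le : |δ * (δ ^ 3 - 2 * (δ * s) + t₃) - s * (δ ^ 2 - s) + t₃ * δ - t₄| ≤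
    4.02 * a ^ 2 := by
  have h1 := h.abs_mul_y₃_le
  have h2 : |s * (δ ^ 2 - s)| ≤ 0.905 * a * (0.905 * a) := by
    rw [abs_mul]
    exact mul_le_mul h.abs_s_le h.abs_y₂_le (abs_nonneg _) (by linarith [h.a_pos])
  have h3 : |t₃ * δ| ≤ 2.05 * a ^ 2 * (1.54 * a) := by
    rw [abs_mul, abs_of_pos h.δ_pos]
    exact mul_le_mul h.abs_t₃_le h.δ_le h.δ_pos.le (by have := h.a_pos; positivity)
  have h4 := h.abs_t₄_le
  rw [abs_le] at h1 h2 h3 h4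
  have := pow_pos h.a_pos 2
  have e1 := h.pow_le 2
  norm_num at *
  exact abs_le.2 ⟨by linarith, by linarith⟩

lemma loss_bounds : 0 ≤ b * (1 + δ) * δ * (2 + δ) ∧
    b * (1 + δ) * δ * (2 + δ) ≤ 1.1 * a ^ 2 + 10.1 * a ^ 3 := by
  have hb := h.b_nonneg
  have hδ := h.δ_pos
  have ha := h.a_pos
  refine ⟨by positivity, ?_⟩
  have h1 : b * (1 + δ) * δ * (2 + δ) ≤
      0.55 * a * (1 + 1.54 * a) * (a + 5.37 * a ^ 2) * (2 + 1.54 * a) := by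
    have h1 := h.b_le
    have h2 := h.δ_le
    have h3 := h.δ_le_quadratic
    gcongr
  have e3 := h.pow_le 3
  have e4 := h.pow_le 4
  have := pow_pos ha 3
  norm_num at *
  linarith

lemma δ_sub_s_sq_le : (δ - s) ^ 2 ≤ a ^ 2 + 20.35 * a ^ 3 := by
  obtain ⟨h1, h2⟩ := h.s_bounds
  have h3 := h.δ_le_quadratic
  have hδ := h.δ_pos
  have ha := h.a_pos
  have ha2 := pow_pos ha 2
  have h4 : (δ - s) ^ 2 ≤ (a + 7.42 * a ^ 2) ^ 2 := by
    apply sq_le_sq'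
    · norm_num at *; linarith
    · norm_num at *; linarith
  have e3 := h.pow_le 3
  have := pow_pos ha 3
  norm_num at *
  linarith

/-- The first-order term `b` cancels against that of `s = b (1 + δ)³ - t₃`, leaving second-order
quantities. -/
lemma main_one : |b * (1 + δ) + (δ ^ 2 - s)| ≤ 3 * a ^ 2 + 60 * a ^ 3 := by
  have e : b * (1 + δ) + (δ ^ 2 - s) = δ ^ 2 + t₃ - b * (1 + δ) * δ * (2 + δ) := by
    rw [h.s_eq]; ring
  have h1 : δ ^ 2 ≤ (a + 5.37 * a ^ 2) ^ 2 := pow_le_pow_left₀ h.δ_pos.le h.δ_le_quadratic 2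
  obtain ⟨h2, h3⟩ := h.t₃_bounds
  obtain ⟨h4, h5⟩ := h.loss_bounds
  have e3 := h.pow_le 3
  have := pow_pos h.a_pos 2
  have := pow_pos h.a_pos 3
  have := sq_nonneg δ
  rw [e]
  norm_num at *
  exact abs_le.2 ⟨by linarith, by linarith⟩

lemma main_two : |b * (1 + δ) + (δ ^ 2 - s) + (δ ^ 3 - 2 * (δ * s) + t₃)| ≤
    3 * a ^ 2 + 60 * a ^ 3 := by
  have e : b * (1 + δ) + (δ ^ 2 - s) + (δ ^ 3 - 2 * (δ * s) + t₃) =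
      δ ^ 2 - 2 * (δ * s) + 2 * t₃ - b * (1 + δ) * δ * (2 + δ) + δ ^ 3 := by
    linear_combination -h.s_eq
  have h1 : δ ^ 2 ≤ (a + 5.37 * a ^ 2) ^ 2 := pow_le_pow_left₀ h.δ_pos.le h.δ_le_quadratic 2
  have h6 : s ^ 2 ≤ (0.905 * a) ^ 2 := by
    rw [← sq_abs]
    exact pow_le_pow_left₀ (abs_nonneg _) h.abs_s_le 2
  obtain ⟨h2, h3⟩ := h.t₃_bounds
  obtain ⟨h4, h5⟩ := h.loss_bounds
  have h7 := h.δ_mul_s_bounds.1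
  -- For the lower bound, `δ² - 2 δ s = (δ - s)² - s² ≥ -s²`.
  have h8 := sq_nonneg (δ - s)
  have h9 := h.δ_cube_le
  have h10 := pow_pos h.δ_pos 3
  have e3 := h.pow_le 3
  have := pow_pos h.a_pos 2
  have := pow_pos h.a_pos 3
  rw [e]
  norm_num at *
  exact abs_le.2 ⟨by linarith, by linarith⟩

/-- To second order the sum is `(δ - s)² + 2 t₃ - t₄` minus a nonnegative loss. The square
contributes at most `a²` and `2 t₃` at most `2 a²`, whence the constant 3. -/
lemma main_three : |b * (1 + δ) + (δ ^ 2 - s) + (δ ^ 3 - 2 * (δ * s) + t₃) +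
    (δ * (δ ^ 3 - 2 * (δ * s) + t₃) - s * (δ ^ 2 - s) + t₃ * δ - t₄)| ≤
    3 * a ^ 2 + 60 * a ^ 3 := by
  have e : b * (1 + δ) + (δ ^ 2 - s) + (δ ^ 3 - 2 * (δ * s) + t₃) +
      (δ * (δ ^ 3 - 2 * (δ * s) + t₃) - s * (δ ^ 2 - s) + t₃ * δ - t₄) =
      (δ - s) ^ 2 + 2 * t₃ - t₄ - b * (1 + δ) * δ * (2 + δ) + δ ^ 3 +
      δ * (δ ^ 3 - 2 * (δ * s) + t₃) - s * δ ^ 2 + t₃ * δ := by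
    linear_combination -h.s_eq
  have hy := abs_le.1 h.abs_mul_y₃_le
  have h1 : |s * δ ^ 2| ≤ 0.905 * a * (2.372 * a ^ 2) := by
    rw [abs_mul, abs_of_nonneg (sq_nonneg δ)]
    exact mul_le_mul h.abs_s_le h.sq_le (sq_nonneg δ) (by linarith [h.a_pos])
  have h6 : |t₃ * δ| ≤ 2.05 * a ^ 2 * (1.54 * a) := by
    rw [abs_mul, abs_of_pos h.δ_pos]
    exact mul_le_mul h.abs_t₃_le h.δ_le h.δ_pos.le (by have := h.a_pos; positivity)
  obtain ⟨h2, h3⟩ := h.t₃_bounds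
  obtain ⟨h4, h5⟩ := h.loss_bounds
  obtain ⟨h7, h8⟩ := h.t₄_bounds
  have h9 := h.δ_cube_le
  have h10 := pow_pos h.δ_pos 3
  have h11 := h.δ_sub_s_sq_le
  have h12 := sq_nonneg (δ - s)
  have := pow_pos h.a_pos 2
  have := pow_pos h.a_pos 3
  rw [abs_le] at h1 h6
  rw [e, abs_le]
  obtain ⟨hy1, hy2⟩ := hy
  generalize δ * (δ ^ 3 - 2 * (δ * s) + t₃) = Y at *
  norm_num at *
  exact ⟨by linarith, by linarith⟩

end TailData

end Estimates

/-! ### Approximation of `q n` at the zero -/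

section Approximation

open Finset

lemma TailData.tail_le {a b c d δ s t₃ t₄ T : ℝ} (h : TailData a b c d δ s t₃ t₄ T) {β y : ℕ → ℝ}
    (hβ0 : β 0 = 1) (hβ1 : β 1 = -δ) (hβ2 : β 2 = s) (hβ3 : β 3 = -t₃) (hβ4 : β 4 = t₄)
    (hy0 : y 0 = 1)
    (hβy : ∀ n, ∑ ij ∈ antidiagonal n, β ij.1 * y ij.2 = if n = 0 then 1 else 0)
    (hB : ∀ N, ∑ i ∈ range N, |β (i + 5)| ≤ 7.28 * a ^ 3) (N : ℕ) :
    ∑ n ∈ range N, |y (n + 5)| ≤ 48 * a ^ 3 := by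
  obtain ⟨h1, h2, h3, h4⟩ := renewal_first_terms hβ0 hy0 hβy
  have ha := h.a_pos
  have y1 : |y 1| ≤ 1.54 * a := by
    rw [h1, hβ1, neg_neg, abs_of_pos h.δ_pos]
    exact h.δ_le
  have e2 : y 2 = δ ^ 2 - s := by rw [h2, h1, hβ1, hβ2]; ring
  have e3 : y 3 = δ ^ 3 - 2 * (δ * s) + t₃ := by rw [h3, e2, h1, hβ1, hβ2, hβ3]; ring
  have e4 : y 4 = δ * (δ ^ 3 - 2 * (δ * s) + t₃) - s * (δ ^ 2 - s) + t₃ * δ - t₄ := by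
    rw [h4, e3, e2, h1, hβ1, hβ2, hβ3, hβ4]; ring
  have y2 : |y 2| ≤ 0.905 * a := e2 ▸ h.abs_y₂_le
  have y3 : |y 3| ≤ 3.38 * a ^ 2 := e3 ▸ h.abs_y₃_le
  have y4 : |y 4| ≤ 4.02 * a ^ 2 := e4 ▸ h.abs_y₄_le
  have y0 : |y 0| ≤ 1 := by rw [hy0, abs_one]
  have b1 : |β 1| ≤ 1.54 * a := by
    rw [hβ1, abs_neg, abs_of_pos h.δ_pos]
    exact h.δ_le
  have b2 : |β 2| ≤ 0.905 * a := hβ2 ▸ h.abs_s_le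
  have b3 : |β 3| ≤ 2.05 * a ^ 2 := by rw [hβ3, abs_neg]; exact h.abs_t₃_le
  have b4 : |β 4| ≤ 2.362 * a ^ 2 := hβ4 ▸ h.abs_t₄_le
  have ht := renewal_tail_le hβ0 hβy hB N
  have hR : |β 1| * |y 4| + |β 2| * (|y 3| + |y 4|) + |β 3| * (|y 2| + |y 3| + |y 4|) +
        |β 4| * (|y 1| + |y 2| + |y 3| + |y 4|) +
        7.28 * a ^ 3 * (|y 0| + |y 1| + |y 2| + |y 3| + |y 4|) ≤
      1.54 * a * (4.02 * a ^ 2) + 0.905 * a * (3.38 * a ^ 2 + 4.02 * a ^ 2) +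
        2.05 * a ^ 2 * (0.905 * a + 3.38 * a ^ 2 + 4.02 * a ^ 2) +
        2.362 * a ^ 2 * (1.54 * a + 0.905 * a + 3.38 * a ^ 2 + 4.02 * a ^ 2) +
        7.28 * a ^ 3 * (1 + 1.54 * a + 0.905 * a + 3.38 * a ^ 2 + 4.02 * a ^ 2) := by
    gcongr
  have p1 := h.pow_le 1
  have p2 := h.pow_le 2
  have p3 := h.pow_le 3
  have p4 := h.pow_le 4
  have ha3 := pow_pos ha 3
  have hale := h.a_le
  have hS : 0 ≤ ∑ n ∈ range N, |y (n + 5)| := sum_nonneg fun _ _ => abs_nonneg _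
  set S := ∑ n ∈ range N, |y (n + 5)|
  -- At `a = 0.1` the bounds on `β` add up to less than `0.3`; then `48 = 33.6 / 0.7`.
  have hsum : 0.7 ≤ 1 - (|β 1| + |β 2| + |β 3| + |β 4| + 7.28 * a ^ 3) := by
    norm_num at *
    linarith
  have h5 : S * 0.7 ≤ 33.6 * a ^ 3 := by
    refine (mul_le_mul_of_nonneg_left hsum hS).trans (ht.trans (hR.trans ?_))
    norm_num at *
    linarith
  norm_num at h5
  linarith

lemma geometric_bounds {a : ℝ} (hpos : 0 < a) (hle : a ≤ 1 / 10) {z : ℝ} (hz : 1 ≤ z)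
    (hz1 : z - 1 ≤ 1.54 * a) :
    a * z ^ 2 ≤ 0.1332 ∧ (a * z ^ 2) ^ 3 / (1 - a * z ^ 2) ≤ 2.73 * a ^ 3 ∧
      z * (a * z ^ 2) ^ 3 / (1 - a * z ^ 2) ≤ 3.145 * a ^ 3 := by
  have hzle : z ≤ 1.154 := by norm_num at *; linarith
  have hz2 : z ^ 2 ≤ 1.3318 := (pow_le_pow_left₀ (by linarith) hzle 2).trans (by norm_num)
  have hu : a * z ^ 2 ≤ 0.1332 := by
    calc _ ≤ 1 / 10 * (1.3318 : ℝ) := mul_le_mul hle hz2 (sq_nonneg z) (by norm_num)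
      _ ≤ _ := by norm_num
  have hd : 0.8668 ≤ 1 - a * z ^ 2 := by norm_num at *; linarith
  have hd0 : 0 < 1 - a * z ^ 2 := lt_of_lt_of_le (by norm_num) hd
  have ha3 := pow_pos hpos 3
  have h1 : (a * z ^ 2) ^ 3 / (1 - a * z ^ 2) ≤ 2.7253 * a ^ 3 := by
    rw [div_le_iff₀ hd0]
    calc (a * z ^ 2) ^ 3 ≤ (a * 1.3318) ^ 3 := by gcongr
      _ ≤ 2.7253 * a ^ 3 * 0.8668 := by norm_num; linarith
      _ ≤ _ := by gcongr
  refine ⟨hu, h1.trans (by norm_num; linarith), ?_⟩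
  rw [mul_div_assoc]
  calc _ ≤ 1.154 * (2.7253 * a ^ 3) :=
        mul_le_mul hzle h1 (div_nonneg (by positivity) hd0.le) (by norm_num)
    _ ≤ _ := by norm_num; linarith

namespace IsExceedance

variable {p : ℕ → ℝ} (h : IsExceedance p)
include h

lemma abs_altTail_le {z : ℝ} (hz : 1 ≤ z) (hu : p 1 * z ^ 2 < 1) (i : ℕ) :
    |altTail p z (i + 5)| ≤
      z * (p 1 * z ^ 2) ^ 3 / (1 - p 1 * z ^ 2) * (p 1 * z ^ 2) ^ (i / 2) := by
  have hz0 : 0 ≤ z := by linarith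
  have hu0 : 0 ≤ p 1 * z ^ 2 := mul_nonneg (h.nonneg 1) (sq_nonneg z)
  have hd : 0 < 1 - p 1 * z ^ 2 := by linarith
  rcases Nat.even_or_odd' i with ⟨m, rfl | rfl⟩
  · rw [show 2 * m + 5 = 2 * (m + 2) + 1 by ring, show 2 * m / 2 = m by omega]
    obtain ⟨h1, h2⟩ := h.altTail_odd_bounds hz0 hu (m + 2)
    have e : z * (p 1 * z ^ 2) ^ 3 / (1 - p 1 * z ^ 2) * (p 1 * z ^ 2) ^ m =
      z * (p 1 * z ^ 2) ^ (m + 2 + 1) / (1 - p 1 * z ^ 2) := by ring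
    rw [e]
    refine abs_le.2 ⟨h1, h2.trans ?_⟩
    gcongr
    exact le_mul_of_one_le_left (pow_nonneg hu0 _) hz
  · rw [show 2 * m + 1 + 5 = 2 * (m + 2) + 2 by ring, show (2 * m + 1) / 2 = m by omega]
    obtain ⟨h1, h2⟩ := h.altTail_even_bounds hz0 hu (m + 2)
    have e : z * (p 1 * z ^ 2) ^ 3 / (1 - p 1 * z ^ 2) * (p 1 * z ^ 2) ^ m =
      z * (p 1 * z ^ 2) ^ (m + 2 + 1) / (1 - p 1 * z ^ 2) := by ring
    rw [e]
    refine abs_le.2 ⟨(neg_le_neg ?_).trans h1, h2⟩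
    gcongr
    refine (pow_le_pow_of_le_one hu0 hu.le (Nat.le_succ _)).trans ?_
    exact le_mul_of_one_le_left (pow_nonneg hu0 _) hz

lemma sum_abs_altTail_le (hpos : 0 < p 1) (hle : p 1 ≤ 1 / 10) {z : ℝ} (hz : 1 ≤ z)
    (hz1 : z - 1 ≤ 1.54 * p 1) (N : ℕ) :
    ∑ i ∈ range N, |altTail p z (i + 5)| ≤ 7.28 * p 1 ^ 3 := by
  obtain ⟨hu, -, h2⟩ := geometric_bounds hpos hle hz hz1
  have hu1 : p 1 * z ^ 2 < 1 := hu.trans_lt (by norm_num)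
  have hu0 : 0 ≤ p 1 * z ^ 2 := by positivity
  have ha3 := pow_pos hpos 3
  calc _ ≤ ∑ i ∈ range N, z * (p 1 * z ^ 2) ^ 3 / (1 - p 1 * z ^ 2) * (p 1 * z ^ 2) ^ (i / 2) :=
        sum_le_sum fun i _ => h.abs_altTail_le hz hu1 i
    _ = z * (p 1 * z ^ 2) ^ 3 / (1 - p 1 * z ^ 2) * ∑ i ∈ range N, (p 1 * z ^ 2) ^ (i / 2) := by
        rw [mul_sum]
    _ ≤ 3.145 * p 1 ^ 3 * (2 / 0.8668) := by
        refine mul_le_mul h2 ((sum_range_pow_half_le hu0 hu1 N).trans ?_)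
          (sum_nonneg fun i _ => by positivity) (by positivity)
        gcongr
        norm_num at *
        linarith
    _ ≤ _ := by norm_num; linarith

lemma tailData (hpos : 0 < p 1) (hle : p 1 ≤ 1 / 10) (h2 : 2 * p 2 ≤ p 1 + p 3) {z : ℝ}
    (hz : 1 < z) (hu : p 1 * z ^ 2 < 0.18) (h0 : altTail p z 0 = 1) :
    altTail p z 1 = z - 1 ∧
      TailData (p 1) (p 2) (p 3) (p 4) (z - 1) (altTail p z 2) (altTail p z 3) (altTail p z 4)
        (altTail p z 5) := by
  have hu1 : p 1 * z ^ 2 < 1 := hu.trans (by norm_num)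
  have hz0 : 0 ≤ z := by linarith
  have hcube := h.zero_sub_one_le hz hu1 h0
  have hz1 := sub_one_le_of_cubic hpos (hle.trans (by norm_num)) hz hu hcube
  obtain ⟨-, g1, g2⟩ := geometric_bounds hpos hle hz.le hz1
  obtain ⟨t1, t2⟩ := h.altTail_odd_bounds hz0 hu1 2
  have e0 := h.altTail_eq hz0 hu1 0
  have ha3 := pow_pos hpos 3
  refine ⟨by rw [h0, h.zero] at e0; norm_num at e0; linarith, ?_⟩
  exact
    { a_pos := hpos
      a_le := hle
      d_nonneg := h.nonneg 4
      d_le := h.anti (by norm_num)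
      c_le := h.odd_le 1
      two_b_le := h2
      b_nonneg := h.nonneg 2
      δ_pos := by linarith
      δ_le := hz1
      δ_le_cube := by rwa [add_sub_cancel]
      s_eq := by rw [add_sub_cancel]; exact h.altTail_eq hz0 hu1 2
      t₃_eq := by rw [add_sub_cancel]; exact h.altTail_eq hz0 hu1 3
      t₄_eq := by rw [add_sub_cancel]; exact h.altTail_eq hz0 hu1 4
      T_lower := by norm_num at *; linarith
      T_upper := t2.trans g1 }

/-- The partial sums of `1, -p 0 z, p 1 z², …` at a zero of the generating function. -/
lemma partialSum_eq_altTail {z : ℝ} (hz : 0 ≤ z) (hu : p 1 * z ^ 2 < 1)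
    (h0 : altTail p z 0 = 1) {c : ℕ → ℝ} (hc0 : c 0 = 1)
    (hc : ∀ n, c (n + 1) = (-1) ^ (n + 1) * p n * z ^ (n + 1)) (n : ℕ) :
    ∑ k ∈ range (n + 1), c k = (-1) ^ n * altTail p z n := by
  induction n with
  | zero => simp [hc0, h0]
  | succ n ih =>
    rw [sum_range_succ, ih, hc, h.altTail_eq hz hu n]
    ring

lemma abs_sub_le (hpos : 0 < p 1) (hle : p 1 ≤ 1 / 10) (h2 : 2 * p 2 ≤ p 1 + p 3)
    {q : ℕ → ℝ} (hq : ∀ n, q n = ∑ i ∈ range n, (-1) ^ i * p i * q (n - 1 - i) + (-1) ^ n * p n)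
    {z : ℝ} (hz : 1 < z) (hu : p 1 * z ^ 2 < 0.18) (h0 : altTail p z 0 = 1) {n : ℕ}
    (hn : 1 ≤ n) : |q n * z ^ n - (1 - p 2)| ≤ 3 * p 1 ^ 2 + 112 * p 1 ^ 3 := by
  have hu1 : p 1 * z ^ 2 < 1 := hu.trans (by norm_num)
  have hz0 : 0 ≤ z := by linarith
  obtain ⟨h1, hT⟩ := h.tailData hpos hle h2 hz hu h0
  obtain ⟨c, hc0, hc⟩ : ∃ c : ℕ → ℝ, c 0 = 1 ∧
      ∀ n, c (n + 1) = (-1) ^ (n + 1) * p n * z ^ (n + 1) :=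
    ⟨fun n => Nat.casesOn n 1 fun n => (-1) ^ (n + 1) * p n * z ^ (n + 1), rfl, fun _ => rfl⟩
  -- The shift amounts to `q (-1) = 1`, which turns the isolated last term of the recursion into an
  -- ordinary term of the convolution.
  obtain ⟨r, hr0, hr⟩ : ∃ r : ℕ → ℝ, r 0 = 1 ∧ ∀ n, r (n + 1) = q n * z ^ (n + 1) :=
    ⟨fun n => Nat.casesOn n 1 fun n => q n * z ^ (n + 1), rfl, fun _ => rfl⟩
  obtain ⟨y, hy0, hy⟩ : ∃ y : ℕ → ℝ, y 0 = 1 ∧ ∀ n, y (n + 1) = r (n + 1) - r n :=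
    ⟨fun n => Nat.casesOn n 1 fun n => r (n + 1) - r n, rfl, fun _ => rfl⟩
  have hcr : ∀ n, ∑ ij ∈ antidiagonal n, c ij.1 * r ij.2 = if n = 0 then 1 else 0 := by
    intro n
    rcases n with _ | n
    · simp [hc0, hr0]
    · rw [Nat.sum_antidiagonal_succ, hc0, hr,
        Nat.sum_antidiagonal_eq_sum_range_succ (fun i j => c (i + 1) * r j), sum_range_succ,
        Nat.sub_self, hr0, hc, hq n]
      have : ∑ k ∈ range n, c (k + 1) * r (n - k) =
          -((∑ k ∈ range n, (-1) ^ k * p k * q (n - 1 - k)) * z ^ (n + 1)) := by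
        rw [sum_mul, ← sum_neg_distrib]
        refine sum_congr rfl fun k hk => ?_
        have hk := mem_range.1 hk
        obtain ⟨m, rfl⟩ : ∃ m, n = k + 1 + m := ⟨n - k - 1, by omega⟩
        rw [show k + 1 + m - k = m + 1 by omega, show k + 1 + m - 1 - k = m by omega, hc, hr]
        ring
      rw [this]
      simp
      ring
  have hβ := h.partialSum_eq_altTail hz0 hu1 h0 hc0 hc
  have hβy := sum_antidiagonal_partialSum_mul_diff hcr (hy0.trans hr0.symm) hy
  simp only [hβ] at hβy
  obtain ⟨β, hβdef⟩ : ∃ β : ℕ → ℝ, ∀ n, β n = (-1) ^ n * altTail p z n := ⟨_, fun _ => rfl⟩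
  simp only [← hβdef] at hβy
  have hβ0 : β 0 = 1 := by simp [hβdef, h0]
  have hβ1 : β 1 = -(z - 1) := by simp [hβdef, h1]
  have hβ2 : β 2 = altTail p z 2 := by simp [hβdef]
  have hβ3 : β 3 = -altTail p z 3 := by rw [hβdef]; norm_num
  have hβ4 : β 4 = altTail p z 4 := by rw [hβdef]; norm_num
  obtain ⟨h1, e2, e3, e4⟩ := renewal_first_terms hβ0 hy0 hβy
  have e1 : y 1 = z - 1 := by rw [h1, hβ1, neg_neg]
  have e2 : y 2 = (z - 1) ^ 2 - altTail p z 2 := by rw [e2, e1, hβ1, hβ2]; ring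
  have e3 : y 3 = (z - 1) ^ 3 - 2 * ((z - 1) * altTail p z 2) + altTail p z 3 := by
    rw [e3, e2, e1, hβ1, hβ2, hβ3]; ring
  have e4 : y 4 = (z - 1) * ((z - 1) ^ 3 - 2 * ((z - 1) * altTail p z 2) + altTail p z 3) -
      altTail p z 2 * ((z - 1) ^ 2 - altTail p z 2) + altTail p z 3 * (z - 1) -
      altTail p z 4 := by
    rw [e4, e3, e2, e1, hβ1, hβ2, hβ3, hβ4]; ring
  have hsum : ∀ m, ∑ j ∈ range (m + 1), y j = r m := by
    intro m
    induction m with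
    | zero => simp [hy0, hr0]
    | succ m ih => rw [sum_range_succ, ih, hy]; ring
  have ha3 := pow_pos hpos 3
  have hz12 : 1 + (z - 1) = z := by ring
  -- The extra `z` produces `r (n + 1) = y 0 + … + y (n + 1)`, where `y 0 + y 1 = z` cancels; it is
  -- dropped at the end since `z ≥ 1`.
  have key : |z * (q n * z ^ n - (1 - p 2))| ≤ 3 * p 1 ^ 2 + 112 * p 1 ^ 3 := by
    have e : z * (q n * z ^ n - (1 - p 2)) = ∑ j ∈ range (n + 2), y j - z + p 2 * z := by
      rw [hsum, hr]; ring
    rw [e]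
    have hcases : n = 1 ∨ n = 2 ∨ ∃ m, n = m + 3 := by
      by_cases h3 : n < 3
      · omega
      · exact Or.inr (Or.inr ⟨n - 3, by omega⟩)
    rcases hcases with rfl | rfl | ⟨m, rfl⟩
    · have hm := hT.main_one
      rw [hz12, ← e2] at hm
      have : ∑ j ∈ range (1 + 2), y j - z + p 2 * z = p 2 * z + y 2 := by
        simp only [sum_range_succ, sum_range_zero, hy0, e1, Nat.reduceAdd]; ring
      rw [this]
      linarith
    · have hm := hT.main_two
      rw [hz12, ← e2, ← e3] at hm
      have : ∑ j ∈ range (2 + 2), y j - z + p 2 * z = p 2 * z + y 2 + y 3 := by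
        simp only [sum_range_succ, sum_range_zero, hy0, e1, Nat.reduceAdd]; ring
      rw [this]
      linarith
    · have hm := hT.main_three
      rw [hz12, ← e4, ← e2, ← e3] at hm
      have : ∑ j ∈ range (m + 3 + 2), y j - z + p 2 * z =
          p 2 * z + y 2 + y 3 + y 4 + ∑ j ∈ range m, y (j + 5) := by
        rw [show m + 3 + 2 = m + 1 + 1 + 1 + 1 + 1 by ring]
        simp only [sum_range_succ', zero_add, hy0, e1, add_assoc, Nat.reduceAdd]
        ring
      rw [this]
      have ht := hT.tail_le hβ0 hβ1 hβ2 hβ3 hβ4 hy0 hβy (fun N => by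
        simp only [hβdef, abs_mul, abs_pow, abs_neg, abs_one, one_pow, one_mul]
        exact h.sum_abs_altTail_le hpos hle hz.le hT.δ_le N) m
      have := (abs_add_le (p 2 * z + y 2 + y 3 + y 4) (∑ j ∈ range m, y (j + 5))).trans
        (add_le_add hm ((abs_sum_le_sum_abs _ _).trans ht))
      linarith
  rw [abs_mul, abs_of_nonneg hz0] at key
  exact (le_mul_of_one_le_left (abs_nonneg _) hz.le).trans key

end IsExceedance

end Approximation

/-! ### Passage to the probabilistic setting -/

section Conclusion

variable {Ω : Type*} [MeasurableSpace Ω] {μ : Measure Ω} {X : ℕ → Ω → ℝ} {x : ℝ}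

lemma isExceedance_p [IsProbabilityMeasure μ] (hX : ∀ i, Measurable (X i))
    (hstat : StrictlyStationary μ X) (hdep : OneDep μ X) : IsExceedance (p μ X x) where
  zero := p_zero
  nonneg := p_nonneg
  anti := p_anti
  add_add_one_le := p_add_add_one_le hX hstat hdep

lemma seriesTerm_eq_neg (z : ℝ) :
    seriesTerm μ X x z = fun k => -((-1) ^ k * p μ X x (0 + k) * z ^ (0 + 1 + k)) := by
  funext k
  rw [seriesTerm, zero_add, show 0 + 1 + k = k + 1 by ring]
  ring

lemma C_eq_one_sub_altTail : C μ X x = fun z => 1 - altTail (p μ X x) z 0 := by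
  funext z
  rw [C, seriesTerm_eq_neg, tsum_neg, altTail, sub_eq_add_neg]

end Conclusion

end OneDependent

end

theorem corollaryC2 {Ω : Type*} [MeasurableSpace Ω] (μ : Measure Ω) [IsProbabilityMeasure μ]
    (X : ℕ → Ω → ℝ) (hX : ∀ i, Measurable (X i))
    (hstat : OneDependent.StrictlyStationary μ X) (hdep : OneDependent.OneDep μ X)
    (x α : ℝ) (hp_pos : 0 < OneDependent.p μ X x 1) (hp_le : OneDependent.p μ X x 1 ≤ α)
    (hα : α ≤ 0.1)
    (t₂ l : ℝ) (ht₂ : OneDependent.IsSecondRoot α t₂) (hl : t₂ ^ 3 < l)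
    (hbr : 0 < OneDependent.bracketE α l) :
    (∀ z ∈ Set.Ioo 1 (1 + l * OneDependent.p μ X x 1),
      Summable (OneDependent.seriesTerm μ X x z)) ∧
    ∃ lam ∈ Set.Ioo 1 (1 + l * OneDependent.p μ X x 1),
      (OneDependent.C μ X x lam = 0 ∧
        deriv (OneDependent.C μ X x) lam ≠ 0 ∧
        ∀ z ∈ Set.Ioo 1 (1 + l * OneDependent.p μ X x 1),
          OneDependent.C μ X x z = 0 → z = lam) ∧
      ∀ n : ℕ, 1 ≤ n →
        |OneDependent.q μ X x n * lam ^ n - (1 - OneDependent.p μ X x 2)|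
          ≤ (3 + α * OneDependent.coeffGamma α l) * OneDependent.p μ X x 1 ^ 2 := by
  have h := OneDependent.isExceedance_p (x := x) hX hstat hdep
  have h2 := OneDependent.two_mul_p_two_le (x := x) hX hstat
  have hq := OneDependent.q_eq_sum (x := x) hX hstat hdep
  rw [OneDependent.C_eq_one_sub_altTail]
  generalize OneDependent.q μ X x = q at *
  simp only [OneDependent.seriesTerm_eq_neg]
  generalize OneDependent.p μ X x = p at *
  have hα0 : 0 < α := hp_pos.trans_le hp_le
  have hl1 : 1 < l := (one_lt_pow₀ (ht₂.one_lt hα0) three_ne_zero).trans hl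
  have hη := OneDependent.mul_eta_sq_lt hα0 hα (by linarith) hbr
  have hcube := OneDependent.cube_lt_of_isSecondRoot hα0 ht₂ hl hη
  have hW1 : 1 < 1 + l * p 1 := by nlinarith
  have hWη : 1 + l * p 1 ≤ OneDependent.eta α l := by
    simp only [OneDependent.eta]
    gcongr
  have hu : p 1 * (1 + l * p 1) ^ 2 < 0.18 := by
    refine lt_of_le_of_lt ?_ hη
    gcongr
  -- The right end of the interval is past the first positive root of the cubic for `p 1`: there `l
  -- > η³ ≥ (1 + l p₁)³`.
  have hW3 : p 1 * (1 + l * p 1) ^ 3 < 1 + l * p 1 - 1 := by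
    have : (1 + l * p 1) ^ 3 < l := lt_of_le_of_lt (by gcongr) hcube
    nlinarith
  have hp10 := hp_le.trans hα
  have huz : ∀ z ∈ Set.Ioo 1 (1 + l * p 1), p 1 * z ^ 2 < 0.18 := fun z hz =>
    lt_of_le_of_lt (by have := hz.1; have := hz.2.le; gcongr) hu
  refine ⟨fun z hz => ?_, ?_⟩
  · exact (h.summable_altTail (by linarith [hz.1])
      ((huz z hz).trans (by norm_num)) 0).neg
  obtain ⟨lam, hlam, h0, hd, huniq⟩ := h.exists_unique_zero hp_pos hp10 h2 hW1 hu hW3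
  refine ⟨lam, hlam, ⟨by simp [h0], ?_, fun z hz hz0 => huniq z hz (by linarith)⟩, fun n hn => ?_⟩
  · rw [deriv_const_sub]
    exact neg_ne_zero.2 hd.ne'
  · have hmain := h.abs_sub_le hp_pos (hp10.trans (by norm_num)) h2 hq hlam.1 (huz lam hlam) h0 hn
    have hΓ := OneDependent.coeffGamma_lower hα0 hα hl1 hη hbr
    have hαΓ : p 1 * 112 ≤ α * OneDependent.coeffGamma α l := by gcongr
    have := mul_le_mul_of_nonneg_right hαΓ (sq_nonneg (p 1))
    linarith
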